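/- Let $(\xi_n)_{n\in\mathbb Z}$ be i.i.d. real random variables on a probability space $(\Omega,\mathcal F,\mathbb P)$, let $r\ge 1$ with $\xi_0\in L^{2r}$, let $(a_n)_{n\in\mathbb Z}\in\ell^1$ be real, and put $Y_n=\sum_{k\in\mathbb Z}a_k\xi_{n-k}$. Let $\Lambda$ be the class of non-decreasing continuous bounded functions $\varphi$ on $[0,\infty)$ with $\varphi(0)=0$ such that either $\varphi^2$ is concave, or $\varphi(x)=\min(1,x^\alpha)$ for all $x\ge0$, for some $0<\alpha\le1$. Let $\varphi\in\Lambda$ and let $f:\mathbb R\to\mathbb R$ satisfy $$|f(x)-f(y)|\le\varphi(|x-y|)\,(1+|x|^r+|y|^r)\qquad\text{for all }x,y\in\mathbb R.$$ Assume that $$\sum_{n\in\mathbb Z}\varphi(|a_n|)<\infty\qquad\text{or}\qquad\sum_{n\ge1}\frac{1}{\sqrt n}\,\varphi\Big(\sum_{|k|\ge n}|a_k|\Big)<\infty .$$ Then the series defining $Y_n$ converges almost surely, $f(Y_n)\in L^2$, and $X_n=f(Y_n)-\mathbb E f(Y_n)$ has the following properties. Write $\mathcal F_n=\sigma(\dots,\xi_{n-1},\xi_n)$,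 $P_nZ=\mathbb E(Z|\mathcal F_n)-\mathbb E(Z|\mathcal F_{n-1})$, $S_n=X_0+\dots+X_{n-1}$ and $L=\max(\log,1)$. 1. $\|X_0\|_{H_2}:=\sum_{n\in\mathbb Z}\|P_nX_0\|_2<\infty$. 2. For every $1\le p<2$, $$\sup_{t>0}\,t\;\mathbb P\Big(\sup_{n\ge1}\frac{|S_n|}{\sqrt{nL(L(n))}}>t\Big)^{1/p}\le C_p\,\|X_0\|_{H_2},$$ where $C_p>0$ is a universal constant: it depends only on $p$, and not on the probability space, $(\xi_n)$, $(a_n)$, $f$, $\varphi$ or $r$. 3. The series $d=\sum_{m\in\mathbb Z}P_1(X_m)$ converges in $L^2$ to an $\mathcal F_1$-measurable variable with $\mathbb E(d|\mathcal F_0)=0$, and, writing $d=g((\xi_j)_{j\in\mathbb Z})$ for a measurable $g$, $d_k=g((\xi_{j+k})_{j\in\mathbb Z})$ (that is, $d_k=d\circ\theta^k$ with $\theta$ the shift) and $M_n=d_0+\dots+d_{n-1}$, one has $|S_n-M_n|=o\big(\sqrt{nL(L(n))}\big)$ almost surely. -/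

import Mathlib

open MeasureTheory ProbabilityTheory Filter Topology Asymptotics
open scoped ENNReal

noncomputable section

/-- The truncated logarithm `L = max (log, 1)`. -/
def truncLog (x : ℝ) : ℝ := max (Real.log x) 1

/-- The normalization `√(n L(L(n)))` of the law of the iterated logarithm. -/
def lilNorm (n : ℕ) : ℝ := √((n : ℝ) * truncLog (truncLog (n : ℝ)))

/-- The class `Λ` of non-decreasing, continuous, bounded functions `φ` on `[0, ∞)` with
`φ 0 = 0`, such that either `φ ^ 2` is concave or `φ x = min (1, x ^ α)` with `0 < α ≤ 1`.
Only the values of `φ : ℝ → ℝ` on `[0, ∞)` matter. -/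
structure IsClassLambda (φ : ℝ → ℝ) : Prop where
  monotoneOn : MonotoneOn φ (Set.Ici 0)
  continuousOn : ContinuousOn φ (Set.Ici 0)
  bounded : ∃ K : ℝ, ∀ x, 0 ≤ x → |φ x| ≤ K
  map_zero : φ 0 = 0
  shape : ConcaveOn ℝ (Set.Ici 0) (fun x => φ x ^ 2) ∨
    ∃ α : ℝ, 0 < α ∧ α ≤ 1 ∧ ∀ x, 0 ≤ x → φ x = min 1 (x ^ α)

section LinProc

variable {Ω : Type*} [MeasurableSpace Ω]

/-- The σ-algebra `ℱ_n = σ(…, ξ_{n-1}, ξ_n)` generated by the past of a two-sided sequence. -/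
abbrev pastSigma (ξ : ℤ → Ω → ℝ) (n : ℤ) : MeasurableSpace Ω :=
  ⨆ j : ℤ, ⨆ _ : j ≤ n, MeasurableSpace.comap (ξ j) inferInstance

/-- The projection `P_n Z = E(Z | ℱ_n) - E(Z | ℱ_{n-1})`. -/
def martProj (μ : Measure Ω) (ξ : ℤ → Ω → ℝ) (n : ℤ) (Z : Ω → ℝ) : Ω → ℝ :=
  μ[Z | pastSigma ξ n] - μ[Z | pastSigma ξ (n - 1)]

/-- The Hannan norm `∑_{n ∈ ℤ} ‖P_n Z‖₂`, with values in `[0, ∞]`. -/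
def hannanNorm (μ : Measure Ω) (ξ : ℤ → Ω → ℝ) (Z : Ω → ℝ) : ℝ≥0∞ :=
  ∑' n : ℤ, eLpNorm (martProj μ ξ n Z) 2 μ

/-- The weak `L^p` quasi-norm `sup_{t > 0} t (μ (Z > t)) ^ (1/p)` of a nonnegative function. -/
def weakNorm (μ : Measure Ω) (p : ℝ) (Z : Ω → ℝ≥0∞) : ℝ≥0∞ :=
  ⨆ t : ℝ, ⨆ _ : 0 < t, ENNReal.ofReal t * (μ {ω | ENNReal.ofReal t < Z ω}) ^ (1 / p)

/-- The partial sums `X_0 + ⋯ + X_{n-1}`. -/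
def partialSum (X : ℕ → Ω → ℝ) (n : ℕ) (ω : Ω) : ℝ := ∑ k ∈ Finset.range n, X k ω

/-- The maximal function `sup_{n ≥ 1} |X_0 + ⋯ + X_{n-1}| / √(n L(L(n)))`, in `[0, ∞]`. -/
def lilMaximal (X : ℕ → Ω → ℝ) (ω : Ω) : ℝ≥0∞ :=
  ⨆ n : ℕ, ⨆ _ : 1 ≤ n, ENNReal.ofReal (|partialSum X n ω| / lilNorm n)

/-- The linear process `Y_n = ∑_{k ∈ ℤ} a_k ξ_{n-k}`. -/
def linProcess (a : ℤ → ℝ) (ξ : ℤ → Ω → ℝ) (n : ℤ) (ω : Ω) : ℝ :=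
  ∑' k : ℤ, a k * ξ (n - k) ω

/-- The centered process `X_n = f(Y_n) - E f(Y_n)`, with `Y` the linear process. -/
def funLinProcess (μ : Measure Ω) (f : ℝ → ℝ) (a : ℤ → ℝ) (ξ : ℤ → Ω → ℝ) (n : ℤ) (ω : Ω) : ℝ :=
  f (linProcess a ξ n ω) - ∫ ω', f (linProcess a ξ n ω') ∂μ

/-- The stationary sequence `n ↦ g(θ^n ξ)`, where `θ` is the shift of two-sided sequences:
`g` is applied to `(ξ_{j+n})_{j ∈ ℤ}`. If `ξ_{n+1} = ξ_n ∘ T` for a transformation `T` of `Ω`,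
this is the sequence `Z ∘ T^n` with `Z = g(ξ)`. -/
def shiftProcess (g : (ℤ → ℝ) → ℝ) (ξ : ℤ → Ω → ℝ) (n : ℕ) (ω : Ω) : ℝ :=
  g (fun j => ξ (j + n) ω)

/-- The conclusion of the Hannan-type theorem for the real stationary process `X` over the
filtration generated by `ξ`, with the constant `C p` in the weak `L^p` maximal inequality. -/
structure HannanConclusion (C : ℝ → ℝ) (μ : Measure Ω) (ξ : ℤ → Ω → ℝ) (X : ℤ → Ω → ℝ) :
    Prop where
  hannan_lt_top : hannanNorm μ ξ (X 0) < ∞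
  maximal : ∀ p : ℝ, 1 ≤ p → p < 2 →
    weakNorm μ p (lilMaximal fun n : ℕ => X n) ≤ ENNReal.ofReal (C p) * hannanNorm μ ξ (X 0)
  martingale_approx : ∃ g : (ℤ → ℝ) → ℝ, Measurable g ∧
    StronglyMeasurable[pastSigma ξ 1] (shiftProcess g ξ 0) ∧
    MemLp (shiftProcess g ξ 0) 2 μ ∧
    -- `d = ∑_{m ∈ ℤ} P_1(X_m)` in `L²`, where `d = g(ξ)`
    Tendsto (fun s : Finset ℤ =>
      eLpNorm (shiftProcess g ξ 0 - ∑ m ∈ s, martProj μ ξ 1 (X m)) 2 μ) atTop (𝓝 0) ∧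
    μ[shiftProcess g ξ 0 | pastSigma ξ 0] =ᵐ[μ] 0 ∧
    ∀ᵐ ω ∂μ, (fun n : ℕ => partialSum (fun k : ℕ => X k) n ω - partialSum (shiftProcess g ξ) n ω)
      =o[atTop] lilNorm

end LinProc

end

noncomputable section

section General

variable {Ω Ω' : Type*} {m : MeasurableSpace Ω'} {mΩ : MeasurableSpace Ω} {mΩ' : MeasurableSpace Ω'}

/-- Conditional expectations commute with measure preserving maps. -/
theorem condExp_comp_measurePreserving {μ : Measure Ω} [IsFiniteMeasure μ] {ν : Measure Ω'}
    [IsFiniteMeasure ν] {T : Ω → Ω'} (hT : MeasurePreserving T μ ν)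
    (hm : m ≤ mΩ') {Z : Ω' → ℝ} (hZ : Integrable Z ν) :
    μ[Z ∘ T | m.comap T] =ᵐ[μ] ν[Z | m] ∘ T := by
  have hle : m.comap T ≤ mΩ := (MeasurableSpace.comap_mono hm).trans hT.measurable.comap_le
  have hset : ∀ {g : Ω' → ℝ} {t : Set Ω'}, Integrable g ν → MeasurableSet[m] t →
      ∫ x in T ⁻¹' t, (g ∘ T) x ∂μ = ∫ y in t, g y ∂ν := by
    intro g t hg ht
    have hg' : AEStronglyMeasurable g (Measure.map T μ) := by
      rw [hT.map_eq]; exact hg.aestronglyMeasurable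
    have h := setIntegral_map (hm t ht) hg' hT.measurable.aemeasurable
    rw [hT.map_eq] at h
    exact h.symm
  refine (ae_eq_condExp_of_forall_setIntegral_eq hle (hT.integrable_comp_of_integrable hZ)
    (fun s _ _ => (hT.integrable_comp_of_integrable integrable_condExp).integrableOn) ?_ ?_).symm
  · rintro s ⟨t, ht, rfl⟩ -
    rw [hset integrable_condExp ht, hset hZ ht, setIntegral_condExp hm hZ ht]
  · exact (stronglyMeasurable_condExp.comp_measurable
      (comap_measurable T)).aestronglyMeasurable

theorem MeasureTheory.MeasurePreserving.integral_comp_of_aestronglyMeasurable {μ : Measure Ω}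
    {ν : Measure Ω'} {T : Ω → Ω'} (hT : MeasurePreserving T μ ν) {g : Ω' → ℝ}
    (hg : AEStronglyMeasurable g ν) : ∫ x, g (T x) ∂μ = ∫ y, g y ∂ν := by
  rw [← hT.map_eq] at hg ⊢
  exact (integral_map hT.measurable.aemeasurable hg).symm

/-- Maximal functions of the Birkhoff sums, defined by Garsia's recursion. -/
def birkhoffMax (T : Ω → Ω) (F : Ω → ℝ) : ℕ → Ω → ℝ
  | 0 => 0
  | n + 1 => fun x => max 0 (F x + birkhoffMax T F n (T x))

theorem birkhoffMax_nonneg (T : Ω → Ω) (F : Ω → ℝ) (n : ℕ) (x : Ω) : 0 ≤ birkhoffMax T F n x := by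
  cases n with
  | zero => exact le_rfl
  | succ n => exact le_max_left _ _

theorem birkhoffMax_le_succ (T : Ω → Ω) (F : Ω → ℝ) (n : ℕ) (x : Ω) :
    birkhoffMax T F n x ≤ birkhoffMax T F (n + 1) x := by
  induction n generalizing x with
  | zero => exact birkhoffMax_nonneg T F 1 x
  | succ n ih => exact max_le_max le_rfl (by linarith [ih (T x)])

theorem birkhoffSum_le_birkhoffMax (T : Ω → Ω) (F : Ω → ℝ) (n : ℕ) (x : Ω) :
    ∑ i ∈ Finset.range n, F (T^[i] x) ≤ birkhoffMax T F n x := by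
  induction n generalizing x with
  | zero => simp [birkhoffMax]
  | succ n ih =>
    rw [Finset.sum_range_succ', add_comm]
    simp only [Function.iterate_succ_apply, Function.iterate_zero, id]
    exact le_max_of_le_right (by linarith [ih (T x)])

theorem integrable_birkhoffMax {μ : Measure Ω} {T : Ω → Ω} (hT : MeasurePreserving T μ μ)
    {F : Ω → ℝ} (hF : Integrable F μ) (n : ℕ) : Integrable (birkhoffMax T F n) μ := by
  induction n with
  | zero => exact integrable_zero _ _ _
  | succ n ih =>
    exact (integrable_zero Ω ℝ μ).sup (hF.add (hT.integrable_comp_of_integrable ih))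

theorem measurable_birkhoffMax {T : Ω → Ω} (hT : Measurable T) {F : Ω → ℝ} (hF : Measurable F)
    (n : ℕ) : Measurable (birkhoffMax T F n) := by
  induction n with
  | zero => exact measurable_zero
  | succ n ih => exact measurable_const.max (hF.add (ih.comp hT))

/-- The maximal ergodic inequality for nonnegative functions. -/
theorem maximal_ergodic {μ : Measure Ω} [IsProbabilityMeasure μ] {T : Ω → Ω}
    (hT : MeasurePreserving T μ μ) {h : Ω → ℝ} (hm : Measurable h) (hi : Integrable h μ)
    (h0 : ∀ x, 0 ≤ h x) {c : ℝ} (hc : 0 < c) :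
    μ {x | ∃ n : ℕ, c * n < ∑ i ∈ Finset.range n, h (T^[i] x)} ≤
      ENNReal.ofReal ((∫ x, h x ∂μ) / c) := by
  set F : Ω → ℝ := fun x => h x - c with hF
  have hFi : Integrable F μ := hi.sub (integrable_const c)
  have hFm : Measurable F := hm.sub_const c
  set A : ℕ → Set Ω := fun n => {x | 0 < birkhoffMax T F n x} with hA
  have hAm : ∀ n, MeasurableSet (A n) := fun n =>
    measurableSet_lt measurable_const (measurable_birkhoffMax hT.measurable hFm n)
  have hbound : ∀ n, μ (A n) ≤ ENNReal.ofReal ((∫ x, h x ∂μ) / c) := by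
    intro n
    have hMi := integrable_birkhoffMax hT hFi n
    have h1 : 0 ≤ ∫ x in A n, F x ∂μ := by
      have h2 : ∫ x, (birkhoffMax T F n x - birkhoffMax T F n (T x)) ∂μ = 0 := by
        have h3 : Integrable (fun x => birkhoffMax T F n (T x)) μ :=
          hT.integrable_comp_of_integrable hMi
        rw [integral_sub hMi h3, sub_eq_zero]
        exact (hT.integral_comp_of_aestronglyMeasurable hMi.aestronglyMeasurable).symm
      rw [← integral_indicator (hAm n), ← h2]
      refine integral_mono (hMi.sub (hT.integrable_comp_of_integrable hMi))
        (hFi.indicator (hAm n)) fun x => ?_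
      by_cases hx : x ∈ A n
      · rw [Set.indicator_of_mem hx]
        have hx' : 0 < birkhoffMax T F n x := hx
        cases n with
        | zero => simp [birkhoffMax] at hx'
        | succ n =>
          have h3 : birkhoffMax T F (n + 1) x = F x + birkhoffMax T F n (T x) := by
            have : birkhoffMax T F (n + 1) x = max 0 (F x + birkhoffMax T F n (T x)) := rfl
            rw [this] at hx' ⊢
            exact max_eq_right (by_contra fun hn => by
              rw [max_eq_left (not_le.mp hn).le] at hx'; exact lt_irrefl _ hx')
          have := birkhoffMax_le_succ T F n (T x)
          simp only [h3]
          linarith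
      · rw [Set.indicator_of_notMem hx]
        have hx' : birkhoffMax T F n x ≤ 0 := not_lt.mp hx
        simp only
        linarith [birkhoffMax_nonneg T F n (T x)]
    have h3 : ∫ x in A n, F x ∂μ = ∫ x in A n, h x ∂μ - μ.real (A n) * c := by
      rw [integral_sub hi.integrableOn (integrable_const c)]
      simp
    have h4 : ∫ x in A n, h x ∂μ ≤ ∫ x, h x ∂μ :=
      setIntegral_le_integral hi (Eventually.of_forall h0)
    have h5 : μ.real (A n) ≤ (∫ x, h x ∂μ) / c := by
      rw [le_div_iff₀ hc]; linarith
    rw [← ofReal_measureReal]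
    exact ENNReal.ofReal_le_ofReal h5
  have hsub : {x | ∃ n : ℕ, c * n < ∑ i ∈ Finset.range n, h (T^[i] x)} ⊆ ⋃ n, A n := by
    rintro x ⟨n, hn⟩
    refine Set.mem_iUnion.2 ⟨n, ?_⟩
    have h1 := birkhoffSum_le_birkhoffMax T F n x
    simp only [hF, Finset.sum_sub_distrib, Finset.sum_const, Finset.card_range, nsmul_eq_mul] at h1
    exact lt_of_lt_of_le (by linarith) h1
  refine (measure_mono hsub).trans ?_
  exact le_of_tendsto' (tendsto_measure_iUnion_atTop
    (monotone_nat_of_le_succ fun n x hx => lt_of_lt_of_le hx (birkhoffMax_le_succ T F n x))) hbound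

/-- Ville's inequality for nonnegative supermartingales. -/
theorem ville_inequality {μ : Measure Ω} [IsProbabilityMeasure μ] {G : ℕ → MeasurableSpace Ω}
    (hGm : Monotone G) (hG : ∀ n, G n ≤ mΩ) {W : ℕ → Ω → ℝ} (hWm : ∀ n, Measurable[G n] (W n))
    (hWi : ∀ n, Integrable (W n) μ) (hW0 : ∀ n x, 0 ≤ W n x)
    (hsup : ∀ n A, MeasurableSet[G n] A → ∫ x in A, W (n + 1) x ∂μ ≤ ∫ x in A, W n x ∂μ)
    (a : ℝ) (N : ℕ) :
    a * μ.real {x | ∃ k ≤ N, a ≤ W k x} ≤ ∫ x, W 0 x ∂μ := by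
  set B : ℕ → Set Ω := fun n => {x | ∃ k ≤ n, a ≤ W k x} with hB
  have hBm : ∀ n, MeasurableSet[G n] (B n) := by
    intro n
    have : B n = ⋃ k ∈ Finset.range (n + 1), {x | a ≤ W k x} := by
      ext x; simp [hB]
    rw [this]
    refine Finset.measurableSet_biUnion _ fun k hk => ?_
    exact hGm (Nat.lt_succ_iff.1 (Finset.mem_range.1 hk)) _
      (@measurableSet_le _ _ _ _ _ (G k) _ _ _ _ _ (@measurable_const _ _ _ (G k) _) (hWm k))
  suffices H : ∀ n, a * μ.real (B n) + ∫ x in (B n)ᶜ, W n x ∂μ ≤ ∫ x, W 0 x ∂μ by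
    have h1 : 0 ≤ ∫ x in (B N)ᶜ, W N x ∂μ := integral_nonneg fun x => hW0 N x
    linarith [H N]
  intro n
  induction n with
  | zero =>
    have h1 : a * μ.real (B 0) ≤ ∫ x in B 0, W 0 x ∂μ := by
      refine mul_comm a _ ▸ ?_
      have := setIntegral_ge_of_const_le_real (μ := μ) (f := W 0) (c := a) (hG 0 _ (hBm 0))
        (measure_ne_top _ _) (fun x hx => by
          obtain ⟨k, hk, hx⟩ := hx
          rwa [Nat.le_zero.1 hk] at hx) (hWi 0).integrableOn
      linarith
    linarith [integral_add_compl (hG 0 _ (hBm 0)) (hWi 0)]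
  | succ n ih =>
    have hsubB : B n ⊆ B (n + 1) := fun x ⟨k, hk, hx⟩ => ⟨k, hk.trans n.le_succ, hx⟩
    have hm0 := hG n _ (hBm n)
    have hm1 := hG _ _ (hBm (n + 1))
    have hd : μ.real (B (n + 1)) = μ.real (B n) + μ.real (B (n + 1) \ B n) := by
      rw [measureReal_sdiff hsubB hm0]; ring
    have h1 : a * μ.real (B (n + 1) \ B n) ≤ ∫ x in B (n + 1) \ B n, W (n + 1) x ∂μ := by
      have := setIntegral_ge_of_const_le_real (μ := μ) (f := W (n + 1)) (c := a) (hm1.diff hm0)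
        (measure_ne_top _ _) (fun x hx => by
          obtain ⟨⟨k, hk, hx⟩, hx'⟩ := hx
          rcases Nat.lt_succ_iff_lt_or_eq.1 (Nat.lt_succ_of_le hk) with h | h
          · exact absurd ⟨k, Nat.lt_succ_iff.1 h, hx⟩ hx'
          · rwa [h] at hx) (hWi (n + 1)).integrableOn
      linarith
    have h2 : (B n)ᶜ = (B (n + 1) \ B n) ∪ (B (n + 1))ᶜ := by
      ext x
      by_cases hx : x ∈ B n
      · simp [hx, hsubB hx]
      · by_cases hx' : x ∈ B (n + 1) <;> simp [hx, hx']
    have h3 : ∫ x in (B n)ᶜ, W (n + 1) x ∂μ =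
        ∫ x in B (n + 1) \ B n, W (n + 1) x ∂μ + ∫ x in (B (n + 1))ᶜ, W (n + 1) x ∂μ := by
      rw [h2]
      exact setIntegral_union (Set.disjoint_left.2 fun x hx hx' => hx' hx.1) hm1.compl
        (hWi _).integrableOn (hWi _).integrableOn
    have h4 := hsup n _ (hBm n).compl
    rw [hd, mul_add]
    linarith

theorem exp_sub_sq_le (x : ℝ) : Real.exp (x - x ^ 2) ≤ 1 + x + x ^ 2 := by
  have h1 : 0 < 1 - x + x ^ 2 := by nlinarith [sq_nonneg (x - 1 / 2)]
  have h2 : 1 - x + x ^ 2 ≤ Real.exp (-(x - x ^ 2)) := by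
    linarith [Real.add_one_le_exp (-(x - x ^ 2))]
  rw [← neg_neg (x - x ^ 2), Real.exp_neg]
  refine (inv_anti₀ h1 h2).trans ?_
  rw [inv_le_iff_one_le_mul₀ h1]
  nlinarith [sq_nonneg x, sq_nonneg (x ^ 2)]

end General

section Exponential

variable {Ω : Type*} {mΩ : MeasurableSpace Ω}

/-- Square integrable martingale differences `D i` for the filtration `G`, together with
predictable bounds `v i` of their conditional variances. -/
structure IsMartDiff (μ : Measure Ω) (G : ℕ → MeasurableSpace Ω) (D v : ℕ → Ω → ℝ) : Prop where
  mono : Monotone G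
  le : ∀ n, G n ≤ mΩ
  meas : ∀ n, Measurable[G (n + 1)] (D n)
  meas_var : ∀ n, Measurable[G n] (v n)
  memLp : ∀ n, MemLp (D n) 2 μ
  condExp : ∀ n, μ[D n | G n] =ᵐ[μ] 0
  nonneg : ∀ n x, 0 ≤ v n x
  condVar : ∀ n, μ[fun x => D n x ^ 2 | G n] ≤ᵐ[μ] v n

namespace IsMartDiff

variable {μ : Measure Ω} {G : ℕ → MeasurableSpace Ω} {D v : ℕ → Ω → ℝ}

theorem neg (h : IsMartDiff μ G D v) : IsMartDiff μ G (fun n => -D n) v where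
  mono := h.mono
  le := h.le
  meas n := (h.meas n).neg
  meas_var := h.meas_var
  memLp n := (h.memLp n).neg
  condExp n := by
    filter_upwards [condExp_neg (μ := μ) (D n) (G n), h.condExp n] with x hx hx'
    rw [hx, Pi.neg_apply, hx']; simp
  nonneg := h.nonneg
  condVar n := by simpa using h.condVar n

/-- The exponential supermartingale of a sequence of martingale differences. -/
def expMart (D v : ℕ → Ω → ℝ) (l : ℝ) (n : ℕ) (x : Ω) : ℝ :=
  ∏ i ∈ Finset.range n, Real.exp (l * D i x - (l * D i x) ^ 2) * Real.exp (-(l ^ 2 * v i x))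

theorem expMart_eq (l : ℝ) (n : ℕ) (x : Ω) : expMart D v l n x =
    Real.exp (l * ∑ i ∈ Finset.range n, D i x -
      l ^ 2 * ∑ i ∈ Finset.range n, (D i x ^ 2 + v i x)) := by
  simp only [expMart, ← Real.exp_add]
  rw [← Real.exp_sum, Finset.mul_sum, Finset.mul_sum, ← Finset.sum_sub_distrib]
  congr 1
  refine Finset.sum_congr rfl fun i _ => by ring

theorem expMart_nonneg (l : ℝ) (n : ℕ) (x : Ω) : 0 ≤ expMart D v l n x :=
  Finset.prod_nonneg fun _ _ => by positivity

theorem measurable_expMart (h : IsMartDiff μ G D v) (l : ℝ) (n : ℕ) :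
    Measurable[G n] (expMart D v l n) := by
  refine Finset.measurable_prod (m := G n) _ fun i hi => ?_
  have hi' := Finset.mem_range.1 hi
  have h1 : Measurable[G n] (D i) := (h.meas i).mono (h.mono hi') le_rfl
  have h2 : Measurable[G n] (v i) := (h.meas_var i).mono (h.mono hi'.le) le_rfl
  let _ := G n
  exact (((h1.const_mul l).sub ((h1.const_mul l).pow_const 2)).exp).mul
    ((h2.const_mul (l ^ 2)).neg.exp)

theorem expMart_le (h : IsMartDiff μ G D v) (l : ℝ) (n : ℕ) (x : Ω) :
    expMart D v l n x ≤ Real.exp 1 ^ n := by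
  refine (Finset.prod_le_prod (fun _ _ => by positivity) (g := fun _ => Real.exp 1) ?_).trans
    (by simp)
  intro i _
  rw [← Real.exp_add]
  refine Real.exp_le_exp.2 ?_
  nlinarith [sq_nonneg (l * D i x - 1 / 2), mul_nonneg (sq_nonneg l) (h.nonneg i x)]

theorem integrable_expMart [IsProbabilityMeasure μ] (h : IsMartDiff μ G D v) (l : ℝ) (n : ℕ) :
    Integrable (expMart D v l n) μ :=
  Integrable.of_bound (((h.measurable_expMart l n).mono (h.le n) le_rfl).aestronglyMeasurable)
    (Real.exp 1 ^ n) (Eventually.of_forall fun x => by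
      rw [Real.norm_eq_abs, abs_of_nonneg (expMart_nonneg l n x)]; exact h.expMart_le l n x)

theorem setIntegral_expMart_succ_le [IsProbabilityMeasure μ] (h : IsMartDiff μ G D v) (l : ℝ)
    (n : ℕ) (A : Set Ω) (hA : MeasurableSet[G n] A) :
    ∫ x in A, expMart D v l (n + 1) x ∂μ ≤ ∫ x in A, expMart D v l n x ∂μ := by
  have hD1 : Integrable (D n) μ := (h.memLp n).integrable (by norm_num)
  have hD2 : Integrable (fun x => D n x ^ 2) μ := (h.memLp n).integrable_sq
  set w : Ω → ℝ := fun x => expMart D v l n x * Real.exp (-(l ^ 2 * v n x)) with hw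
  set Y : Ω → ℝ := fun x => 1 + l * D n x + l ^ 2 * D n x ^ 2 with hY
  have hYi : Integrable Y μ := ((integrable_const 1).add (hD1.const_mul l)).add (hD2.const_mul _)
  have hwm : Measurable[G n] w := by
    have h1 := h.measurable_expMart l n
    have h2 := h.meas_var n
    let _ := G n
    exact h1.mul (h2.const_mul (l ^ 2)).neg.exp
  have hw0 : ∀ x, 0 ≤ w x := fun x => mul_nonneg (expMart_nonneg l n x) (Real.exp_nonneg _)
  have hwb : ∀ x, ‖w x‖ ≤ Real.exp 1 ^ n := fun x => by
    rw [Real.norm_eq_abs, abs_of_nonneg (hw0 x)]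
    refine (mul_le_of_le_one_right (expMart_nonneg l n x) ?_).trans (h.expMart_le l n x)
    exact Real.exp_le_one_iff.2 (neg_nonpos.2 (mul_nonneg (sq_nonneg l) (h.nonneg n x)))
  have hwYi : Integrable (w * Y) μ :=
    hYi.bdd_mul ((hwm.mono (h.le n) le_rfl).aestronglyMeasurable) (Eventually.of_forall hwb)
  have hYc : μ[Y | G n] ≤ᵐ[μ] fun x => Real.exp (l ^ 2 * v n x) := by
    have e1 := condExp_add (μ := μ) ((integrable_const 1).add (hD1.const_mul l))
      (hD2.const_mul (l ^ 2)) (G n)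
    have e2 := condExp_add (μ := μ) (integrable_const 1) (hD1.const_mul l) (G n)
    have e3 := condExp_smul (μ := μ) l (D n) (G n)
    have e4 := condExp_smul (μ := μ) (l ^ 2) (fun x => D n x ^ 2) (G n)
    have e5 := condExp_const (μ := μ) (h.le n) (1 : ℝ)
    filter_upwards [e1, e2, e3, e4, h.condExp n, h.condVar n] with x e1 e2 e3 e4 e6 e7
    refine le_trans (le_of_eq e1) ?_
    simp only [Pi.add_apply] at e1 e2 ⊢
    refine le_trans (add_le_add (le_of_eq e2) (le_of_eq e4)) ?_
    have e3' : (μ[fun x => l * D n x | G n]) x = 0 := by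
      refine e3.trans ?_
      simp [e6]
    rw [e3', e5]
    simp only [Pi.smul_apply, smul_eq_mul]
    have := Real.add_one_le_exp (l ^ 2 * v n x)
    nlinarith [mul_le_mul_of_nonneg_left e7 (sq_nonneg l)]
  have hstep : ∀ x, expMart D v l (n + 1) x ≤ (w * Y) x := by
    intro x
    have := exp_sub_sq_le (l * D n x)
    simp only [expMart, Finset.prod_range_succ, hw, hY, Pi.mul_apply]
    rw [mul_comm (Real.exp (l * D n x - _)), ← mul_assoc]
    refine mul_le_mul_of_nonneg_left (by linarith [mul_pow l (D n x) 2]) (hw0 x)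
  have hpull := condExp_mul_of_stronglyMeasurable_left (μ := μ) hwm.stronglyMeasurable hwYi hYi
  calc ∫ x in A, expMart D v l (n + 1) x ∂μ
      ≤ ∫ x in A, (w * Y) x ∂μ :=
        setIntegral_mono (h.integrable_expMart l _).integrableOn hwYi.integrableOn hstep
    _ = ∫ x in A, (μ[w * Y | G n]) x ∂μ := (setIntegral_condExp (h.le n) hwYi hA).symm
    _ ≤ ∫ x in A, expMart D v l n x ∂μ := by
        refine setIntegral_mono_ae integrable_condExp.integrableOn
          (h.integrable_expMart l _).integrableOn ?_
        filter_upwards [hpull, hYc] with x hx hx'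
        rw [hx, Pi.mul_apply]
        refine (mul_le_mul_of_nonneg_left hx' (hw0 x)).trans (le_of_eq ?_)
        simp only [hw]
        rw [mul_assoc, ← Real.exp_add]
        simp

theorem tail_one_sided [IsProbabilityMeasure μ] (h : IsMartDiff μ G D v) (N : ℕ) {x y : ℝ}
    (hx : 0 ≤ x) (hy : 0 < y) : μ.real {ω | (∃ k ≤ N, x ≤ ∑ i ∈ Finset.range k, D i ω) ∧
      ∑ i ∈ Finset.range N, (D i ω ^ 2 + v i ω) ≤ y} ≤ Real.exp (-(x ^ 2 / (4 * y))) := by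
  set l : ℝ := x / (2 * y) with hl
  have hl0 : 0 ≤ l := by positivity
  have hV := ville_inequality h.mono h.le (h.measurable_expMart l) (h.integrable_expMart l)
    (expMart_nonneg l) (h.setIntegral_expMart_succ_le l) (Real.exp (x ^ 2 / (4 * y))) N
  have h0 : ∫ ω, expMart D v l 0 ω ∂μ = 1 := by simp [expMart]
  rw [h0, mul_comm, ← le_div_iff₀ (Real.exp_pos _), one_div, ← Real.exp_neg] at hV
  refine (measureReal_mono ?_).trans hV
  rintro ω ⟨⟨k, hk, hx⟩, hQ⟩
  refine ⟨k, hk, ?_⟩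
  rw [expMart_eq]
  refine Real.exp_le_exp.2 ?_
  have hQ' : ∑ i ∈ Finset.range k, (D i ω ^ 2 + v i ω) ≤ y :=
    (Finset.sum_le_sum_of_subset_of_nonneg (Finset.range_mono hk)
      fun i _ _ => add_nonneg (sq_nonneg _) (h.nonneg i ω)).trans hQ
  have h1 := mul_le_mul_of_nonneg_left hx hl0
  have h2 := mul_le_mul_of_nonneg_left hQ' (sq_nonneg l)
  have h3 : l * x - l ^ 2 * y = x ^ 2 / (4 * y) := by rw [hl]; field_simp; ring
  linarith

theorem tail [IsProbabilityMeasure μ] (h : IsMartDiff μ G D v) (N : ℕ) {x y : ℝ}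
    (hx : 0 ≤ x) (hy : 0 < y) :
    μ {ω | (∃ k ≤ N, x ≤ |∑ i ∈ Finset.range k, D i ω|) ∧
      ∑ i ∈ Finset.range N, (D i ω ^ 2 + v i ω) ≤ y} ≤
      ENNReal.ofReal (2 * Real.exp (-(x ^ 2 / (4 * y)))) := by
  have h1 := h.tail_one_sided N hx hy
  have h2 := h.neg.tail_one_sided N hx hy
  rw [← ofReal_measureReal]
  refine ENNReal.ofReal_le_ofReal ?_
  rw [two_mul]
  refine (measureReal_mono ?_).trans ((measureReal_union_le _ _).trans (add_le_add h1 h2))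
  rintro ω ⟨⟨k, hk, hx⟩, hQ⟩
  rcases le_abs.1 hx with hx | hx
  · exact Or.inl ⟨⟨k, hk, hx⟩, hQ⟩
  · refine Or.inr ⟨⟨k, hk, ?_⟩, ?_⟩
    · simpa using hx
    · simpa using hQ

end IsMartDiff

end Exponential

theorem one_le_truncLog (x : ℝ) : 1 ≤ truncLog x := le_max_right _ _

theorem truncLog_mono {x y : ℝ} (hx : 0 < x) (h : x ≤ y) : truncLog x ≤ truncLog y :=
  max_le_max (Real.log_le_log hx h) le_rfl

theorem lilNorm_sq (n : ℕ) : lilNorm n ^ 2 = n * truncLog (truncLog n) :=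
  Real.sq_sqrt (mul_nonneg n.cast_nonneg (zero_le_one.trans (one_le_truncLog _)))

theorem lilNorm_nonneg (n : ℕ) : 0 ≤ lilNorm n := Real.sqrt_nonneg _

theorem sqrt_le_lilNorm (n : ℕ) : √n ≤ lilNorm n :=
  Real.sqrt_le_sqrt (le_mul_of_one_le_right n.cast_nonneg (one_le_truncLog _))

theorem lilNorm_pos {n : ℕ} (hn : 1 ≤ n) : 0 < lilNorm n :=
  (Real.sqrt_pos.2 (by exact_mod_cast hn)).trans_le (sqrt_le_lilNorm n)

theorem lilNorm_mono {m n : ℕ} (hm : 1 ≤ m) (h : m ≤ n) : lilNorm m ≤ lilNorm n := by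
  have hm' : (0 : ℝ) < m := by exact_mod_cast hm
  have hmn : (m : ℝ) ≤ n := by exact_mod_cast h
  exact Real.sqrt_le_sqrt (mul_le_mul hmn (truncLog_mono
    (zero_lt_one.trans_le (one_le_truncLog _)) (truncLog_mono hm' hmn))
    (zero_le_one.trans (one_le_truncLog _)) n.cast_nonneg)

theorem summable_exp_neg_two_mul_truncLog :
    Summable fun j : ℕ => Real.exp (-(2 * truncLog (truncLog ((2 ^ j : ℕ) : ℝ)))) := by
  rw [← summable_nat_add_iff 1]
  have hs : Summable fun j : ℕ => (Real.log 2 ^ 2)⁻¹ * (1 / ((j + 1 : ℕ) : ℝ) ^ 2) :=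
    (((summable_nat_add_iff 1).2 (Real.summable_one_div_nat_pow.2 one_lt_two))).mul_left _
  refine Summable.of_nonneg_of_le (fun _ => (Real.exp_pos _).le) (fun j => ?_) hs
  have hl : 0 < Real.log 2 := Real.log_pos one_lt_two
  have h1 : ((j + 1 : ℕ) : ℝ) * Real.log 2 ≤ truncLog ((2 ^ (j + 1) : ℕ) : ℝ) := by
    refine le_max_of_le_left ?_
    rw [Nat.cast_pow, Real.log_pow, Nat.cast_ofNat]
  have h0 : (0 : ℝ) < ((j + 1 : ℕ) : ℝ) * Real.log 2 := by positivity
  have h2 : Real.log (((j + 1 : ℕ) : ℝ) * Real.log 2) ≤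
      truncLog (truncLog ((2 ^ (j + 1) : ℕ) : ℝ)) :=
    le_max_of_le_left (Real.log_le_log h0 h1)
  calc Real.exp (-(2 * truncLog (truncLog ((2 ^ (j + 1) : ℕ) : ℝ))))
      ≤ Real.exp (-(2 * Real.log (((j + 1 : ℕ) : ℝ) * Real.log 2))) :=
        Real.exp_le_exp.2 (by linarith)
    _ = (Real.log 2 ^ 2)⁻¹ * (1 / ((j + 1 : ℕ) : ℝ) ^ 2) := by
        rw [Real.exp_neg, mul_comm 2, Real.exp_mul, Real.exp_log h0]
        norm_num [mul_pow]

/-- The absolute constant in the tail estimate of the maximal function. -/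
def tailConst : ℝ :=
  2 * Real.exp 2 * (∑' j : ℕ, Real.exp (-(2 * truncLog (truncLog ((2 ^ j : ℕ) : ℝ))))) + Real.exp 2

theorem tailConst_nonneg : 0 ≤ tailConst :=
  add_nonneg (mul_nonneg (by positivity) (tsum_nonneg fun _ => (Real.exp_pos _).le))
    (Real.exp_pos _).le

theorem min_one_tsum_exp_le {k : ℝ} :
    min 1 (∑' j : ℕ, ENNReal.ofReal
      (2 * Real.exp (-(k * truncLog (truncLog ((2 ^ j : ℕ) : ℝ)))))) ≤
      ENNReal.ofReal (tailConst * Real.exp (-k)) := by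
  have hsum0 : 0 ≤ ∑' j : ℕ, Real.exp (-(2 * truncLog (truncLog ((2 ^ j : ℕ) : ℝ)))) :=
    tsum_nonneg fun _ => (Real.exp_pos _).le
  rcases le_total k 2 with hk | hk
  · refine (min_le_left _ _).trans ?_
    rw [ENNReal.one_le_ofReal]
    have h1 : 1 ≤ Real.exp 2 * Real.exp (-k) := by
      rw [← Real.exp_add]; exact Real.one_le_exp (by linarith)
    refine h1.trans (mul_le_mul_of_nonneg_right ?_ (Real.exp_pos _).le)
    have : 0 ≤ 2 * Real.exp 2 * ∑' j : ℕ,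
      Real.exp (-(2 * truncLog (truncLog ((2 ^ j : ℕ) : ℝ)))) := by positivity
    unfold tailConst
    linarith
  · refine (min_le_right _ _).trans ?_
    have hb : ∀ j : ℕ, 2 * Real.exp (-(k * truncLog (truncLog ((2 ^ j : ℕ) : ℝ)))) ≤
        2 * Real.exp 2 * Real.exp (-k) *
          Real.exp (-(2 * truncLog (truncLog ((2 ^ j : ℕ) : ℝ)))) := by
      intro j
      rw [mul_assoc, mul_assoc, ← Real.exp_add, ← Real.exp_add]
      refine mul_le_mul_of_nonneg_left (Real.exp_le_exp.2 ?_) zero_le_two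
      nlinarith [one_le_truncLog (truncLog ((2 ^ j : ℕ) : ℝ))]
    refine (ENNReal.tsum_le_tsum fun j => ENNReal.ofReal_le_ofReal (hb j)).trans ?_
    rw [← ENNReal.ofReal_tsum_of_nonneg (fun _ => by positivity)
      (summable_exp_neg_two_mul_truncLog.mul_left _), tsum_mul_left]
    refine ENNReal.ofReal_le_ofReal ?_
    unfold tailConst
    nlinarith [mul_pos (Real.exp_pos 2) (Real.exp_pos (-k))]

theorem integral_sq_eq_eLpNorm_sq {Ω : Type*} {mΩ : MeasurableSpace Ω} {μ : Measure Ω}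
    {X : Ω → ℝ} (hX : MemLp X 2 μ) :
    ∫ ω, X ω ^ 2 ∂μ = (eLpNorm X 2 μ).toReal ^ 2 := by
  have := hX.eLpNorm_eq_integral_rpow_norm (by norm_num) (by norm_num)
  rw [this, ENNReal.toReal_ofReal (by positivity)]
  simp only [ENNReal.toReal_ofNat, Real.norm_eq_abs, Real.rpow_ofNat, sq_abs]
  rw [← one_div, ← Real.sqrt_eq_rpow, Real.sq_sqrt (integral_nonneg fun x => sq_nonneg _)]

section Stationary

variable {Ω : Type*} {m mΩ : MeasurableSpace Ω} {μ : Measure Ω} [IsProbabilityMeasure μ]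

theorem isMartDiff_iterate {T : Ω → Ω} (hT : MeasurePreserving T μ μ) (hm : m ≤ mΩ)
    (hmT : m ≤ m.comap T) {D : Ω → ℝ} (hD : Measurable[m.comap T] D) (hD2 : MemLp D 2 μ)
    (hD0 : μ[D | m] =ᵐ[μ] 0) :
    IsMartDiff μ (fun n => m.comap T^[n]) (fun n x => D (T^[n] x))
      (fun n x => |(μ[fun y => D y ^ 2 | m]) (T^[n] x)|) where
  mono := monotone_nat_of_le_succ fun n => by
    rw [Function.iterate_succ', ← MeasurableSpace.comap_comp]
    exact MeasurableSpace.comap_mono hmT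
  le n := (MeasurableSpace.comap_mono hm).trans (hT.measurable.iterate n).comap_le
  meas n := by
    rw [Function.iterate_succ', ← MeasurableSpace.comap_comp]
    exact hD.comp (comap_measurable _)
  meas_var n := by
    have h1 : Measurable[m] fun y => |(μ[fun y => D y ^ 2 | m]) y| :=
      continuous_abs.measurable.comp stronglyMeasurable_condExp.measurable
    exact h1.comp (comap_measurable _)
  memLp n := hD2.comp_measurePreserving (hT.iterate n)
  condExp n := by
    have h1 := condExp_comp_measurePreserving (hT.iterate n) hm (hD2.integrable (by norm_num))
    have h2 := (hT.iterate n).quasiMeasurePreserving.ae hD0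
    filter_upwards [h1, h2] with x h1 h2
    exact h1.trans h2
  nonneg _ _ := abs_nonneg _
  condVar n := by
    have h1 := condExp_comp_measurePreserving (hT.iterate n) hm hD2.integrable_sq
    filter_upwards [h1] with x h1
    exact h1.trans_le (le_abs_self _)

theorem lilMaximal_tail {T : Ω → Ω} (hT : MeasurePreserving T μ μ) (hm : m ≤ mΩ)
    (hmT : m ≤ m.comap T) {D : Ω → ℝ} (hD : Measurable[m.comap T] D) (hD2 : MemLp D 2 μ)
    (hD0 : μ[D | m] =ᵐ[μ] 0) (hD1 : ∫ x, D x ^ 2 ∂μ ≤ 1) {t s : ℝ} (ht : 0 < t) (hs : 0 < s) :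
    μ {x | ENNReal.ofReal t < lilMaximal (fun n x => D (T^[n] x)) x} ≤
      ENNReal.ofReal (2 / s + tailConst * Real.exp (-(t ^ 2 / (16 * s)))) := by
  have hM := isMartDiff_iterate hT hm hmT hD hD2 hD0
  have hDm : Measurable D := hD.mono ((MeasurableSpace.comap_mono hm).trans
    hT.measurable.comap_le) le_rfl
  set v : Ω → ℝ := fun x => |(μ[fun y => D y ^ 2 | m]) x| with hv
  have hvm : Measurable v := ((stronglyMeasurable_condExp.mono hm).measurable).abs
  have hvi : Integrable v μ := integrable_condExp.abs
  have hv1 : ∫ x, v x ∂μ ≤ 1 := by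
    refine (integral_abs_condExp_le _).trans ?_
    simpa using hD1
  have e1 := maximal_ergodic hT (hDm.pow_const 2) hD2.integrable_sq (fun x => sq_nonneg _) hs
  have e2 := maximal_ergodic hT hvm hvi (fun x => abs_nonneg _) hs
  set E1 := {x | ∃ n : ℕ, s * n < ∑ i ∈ Finset.range n, D (T^[i] x) ^ 2}
  set E2 := {x | ∃ n : ℕ, s * n < ∑ i ∈ Finset.range n, v (T^[i] x)}
  set F : ℕ → Set Ω := fun j => {x | (∃ k ≤ 2 ^ (j + 1),
    t * lilNorm (2 ^ j) ≤ |∑ i ∈ Finset.range k, D (T^[i] x)|) ∧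
      ∑ i ∈ Finset.range (2 ^ (j + 1)), (D (T^[i] x) ^ 2 + v (T^[i] x)) ≤ 2 * s * 2 ^ (j + 1)}
  have hF : ∀ j, μ (F j) ≤ ENNReal.ofReal (2 * Real.exp (-(t ^ 2 / (16 * s) *
      truncLog (truncLog ((2 ^ j : ℕ) : ℝ))))) := by
    intro j
    refine (hM.tail (2 ^ (j + 1)) (x := t * lilNorm (2 ^ j)) (y := 2 * s * 2 ^ (j + 1))
      (mul_nonneg ht.le (lilNorm_nonneg _)) (by positivity)).trans (le_of_eq ?_)
    congr 4
    rw [mul_pow, lilNorm_sq]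
    push_cast
    field_simp
    ring
  have hsub : {x | ENNReal.ofReal t < lilMaximal (fun n x => D (T^[n] x)) x} ⊆
      E1 ∪ E2 ∪ ⋃ j, F j := by
    intro x hx
    by_contra hcon
    simp only [Set.mem_union, not_or] at hcon
    obtain ⟨⟨h1, h2⟩, h3⟩ := hcon
    have h1 : ∀ n : ℕ, ∑ i ∈ Finset.range n, D (T^[i] x) ^ 2 ≤ s * n := fun n =>
      not_lt.1 fun h => h1 ⟨n, h⟩
    have h2 : ∀ n : ℕ, ∑ i ∈ Finset.range n, v (T^[i] x) ≤ s * n := fun n =>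
      not_lt.1 fun h => h2 ⟨n, h⟩
    simp only [Set.mem_ofPred_eq, lilMaximal, lt_iSup_iff] at hx
    obtain ⟨n, hn, hx⟩ := hx
    have hx := (ENNReal.ofReal_lt_ofReal_iff_of_nonneg ht.le).1 hx
    rw [lt_div_iff₀ (lilNorm_pos hn)] at hx
    refine h3 (Set.mem_iUnion.2 ⟨Nat.log 2 n,
      ⟨n, (Nat.lt_pow_succ_log_self one_lt_two n).le, ?_⟩, ?_⟩)
    · refine le_trans ?_ hx.le
      exact mul_le_mul_of_nonneg_left (lilNorm_mono Nat.one_le_two_pow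
        (Nat.pow_log_le_self 2 (by lia))) ht.le
    · have := add_le_add (h1 (2 ^ (Nat.log 2 n + 1))) (h2 (2 ^ (Nat.log 2 n + 1)))
      rw [Finset.sum_add_distrib]
      push_cast at this
      linarith
  have hU : μ (⋃ j, F j) ≤ ENNReal.ofReal (tailConst * Real.exp (-(t ^ 2 / (16 * s)))) := by
    refine le_trans (le_min prob_le_one ?_) min_one_tsum_exp_le
    exact (measure_iUnion_le _).trans (ENNReal.tsum_le_tsum hF)
  have hE1 : μ E1 ≤ ENNReal.ofReal (1 / s) :=
    e1.trans (ENNReal.ofReal_le_ofReal (div_le_div_of_nonneg_right hD1 hs.le))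
  have hE2 : μ E2 ≤ ENNReal.ofReal (1 / s) :=
    e2.trans (ENNReal.ofReal_le_ofReal (div_le_div_of_nonneg_right hv1 hs.le))
  refine (measure_mono hsub).trans ((measure_union_le _ _).trans ?_)
  refine (add_le_add (measure_union_le _ _) le_rfl).trans ?_
  refine (add_le_add (add_le_add hE1 hE2) hU).trans ?_
  rw [← ENNReal.ofReal_add (by positivity) (by positivity), ← ENNReal.ofReal_add (by positivity)
    (mul_nonneg tailConst_nonneg (Real.exp_pos _).le)]
  refine ENNReal.ofReal_le_ofReal (le_of_eq ?_)
  ring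

end Stationary

theorem summable_pow_mul_exp_neg {a b c : ℝ} (ha : 0 ≤ a) (hb : 1 < b) (hc : 0 < c) :
    Summable fun i : ℕ => a ^ i * Real.exp (-(b ^ i / c)) := by
  obtain ⟨n, hn⟩ := pow_unbounded_of_one_lt a hb
  have hbn : 0 < b ^ n := by positivity
  have hs : Summable fun i : ℕ => (n.factorial * c ^ n) * (a / b ^ n) ^ i :=
    (summable_geometric_of_lt_one (by positivity) ((div_lt_one hbn).2 hn)).mul_left _
  refine Summable.of_nonneg_of_le (fun i => by positivity) (fun i => ?_) hs
  have hu : 0 < b ^ i / c := by positivity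
  have h1 := Real.pow_div_factorial_le_exp _ hu.le n
  have h2 : Real.exp (-(b ^ i / c)) ≤ ((b ^ i / c) ^ n / n.factorial)⁻¹ := by
    rw [Real.exp_neg]
    exact inv_anti₀ (by positivity) h1
  refine (mul_le_mul_of_nonneg_left h2 (by positivity)).trans (le_of_eq ?_)
  rw [div_pow, div_pow, inv_div, ← pow_mul, ← pow_mul, mul_comm i n]
  field_simp

theorem rpow_le_one_add_tsum_indicator {p : ℝ} (hp : 1 ≤ p) (z : ℝ≥0∞) :
    z ^ p ≤ 1 + ∑' i : ℕ, ENNReal.ofReal ((2 : ℝ) ^ p * ((2 : ℝ) ^ p) ^ i) *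
      Set.indicator {y | ENNReal.ofReal (2 ^ i) < y} 1 z := by
  have hp0 : 0 ≤ p := by linarith
  by_cases hz1 : z ≤ 1
  · exact (ENNReal.rpow_le_one hz1 hp0).trans le_self_add
  by_cases hzt : z = ∞
  · subst hzt
    have : (∑' i : ℕ, ENNReal.ofReal ((2 : ℝ) ^ p * ((2 : ℝ) ^ p) ^ i) *
        Set.indicator {y | ENNReal.ofReal (2 ^ i) < y} 1 ∞) = ∞ := by
      rw [← top_le_iff, ← ENNReal.tsum_const_eq_top_of_ne_zero (α := ℕ) (c := 1) one_ne_zero]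
      refine ENNReal.tsum_le_tsum fun i => ?_
      have h2p : (1 : ℝ) ≤ 2 ^ p := Real.one_le_rpow one_le_two hp0
      rw [Set.indicator_of_mem (by simp), Pi.one_apply, mul_one, ENNReal.one_le_ofReal]
      exact one_le_mul_of_one_le_of_one_le h2p (one_le_pow₀ h2p)
    rw [this]; simp
  have hex : ∃ n : ℕ, z ≤ ENNReal.ofReal (2 ^ n) := by
    obtain ⟨n, hn⟩ := pow_unbounded_of_one_lt z.toReal one_lt_two
    exact ⟨n, (ENNReal.le_ofReal_iff_toReal_le hzt (by positivity)).2 hn.le⟩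
  classical
  obtain ⟨k, hk⟩ : ∃ k, Nat.find hex = k + 1 := by
    refine Nat.exists_eq_succ_of_ne_zero fun h0 => hz1 ?_
    have := Nat.find_spec hex
    rw [h0] at this
    simpa using this
  have h1 : z ≤ ENNReal.ofReal (2 ^ (k + 1)) := hk ▸ Nat.find_spec hex
  have h2 : ENNReal.ofReal (2 ^ k) < z := not_le.1 (Nat.find_min hex (by lia))
  refine le_trans ?_ (le_add_self.trans (add_le_add le_rfl (ENNReal.le_tsum k)))
  · rw [Set.indicator_of_mem (by exact h2), Pi.one_apply, mul_one]
    refine (ENNReal.rpow_le_rpow h1 hp0).trans (le_of_eq ?_)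
    rw [ENNReal.ofReal_rpow_of_nonneg (by positivity) hp0]
    congr 1
    rw [← Real.rpow_natCast, ← Real.rpow_mul zero_le_two, ← Real.rpow_natCast,
      ← Real.rpow_mul zero_le_two, ← Real.rpow_add zero_lt_two]
    congr 1
    push_cast
    ring

/-- A bound for the `p`-th moment of the maximal function of normalized martingale differences. -/
def momentConst (p : ℝ) : ℝ :=
  1 + ∑' i : ℕ, ((2 : ℝ) ^ p * ((2 : ℝ) ^ p) ^ i) *
    (2 / ((2 : ℝ) ^ ((p + 2) / 2)) ^ i +
      tailConst * Real.exp (-(((2 : ℝ) ^ ((2 - p) / 2)) ^ i / 16)))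

theorem summable_momentConst {p : ℝ} (hp2 : p < 2) :
    Summable fun i : ℕ => ((2 : ℝ) ^ p * ((2 : ℝ) ^ p) ^ i) *
      (2 / ((2 : ℝ) ^ ((p + 2) / 2)) ^ i +
        tailConst * Real.exp (-(((2 : ℝ) ^ ((2 - p) / 2)) ^ i / 16))) := by
  have h2p : (0 : ℝ) < 2 ^ p := by positivity
  have h2q : (0 : ℝ) < 2 ^ ((p + 2) / 2) := by positivity
  have h1 : Summable fun i : ℕ => (2 * (2 : ℝ) ^ p) * ((2 : ℝ) ^ p / 2 ^ ((p + 2) / 2)) ^ i := by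
    refine (summable_geometric_of_lt_one (by positivity) ((div_lt_one h2q).2 ?_)).mul_left _
    exact Real.rpow_lt_rpow_of_exponent_lt one_lt_two (by linarith)
  have h2 := (summable_pow_mul_exp_neg h2p.le (b := (2 : ℝ) ^ ((2 - p) / 2))
    (Real.one_lt_rpow one_lt_two (by linarith)) (by norm_num : (0 : ℝ) < 16)).mul_left
    ((2 : ℝ) ^ p * tailConst)
  refine (h1.add h2).congr fun i => ?_
  rw [div_pow]
  field_simp

theorem one_le_momentConst {p : ℝ} : 1 ≤ momentConst p := by
  have := tailConst_nonneg
  refine le_add_of_nonneg_right (tsum_nonneg fun i => by positivity)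

section Stationary

variable {Ω : Type*} {m mΩ : MeasurableSpace Ω} {μ : Measure Ω} [IsProbabilityMeasure μ]

theorem measurable_lilMaximal {X : ℕ → Ω → ℝ} (hX : ∀ n, Measurable (X n)) :
    Measurable (lilMaximal X) := by
  unfold lilMaximal partialSum
  refine Measurable.iSup fun n => Measurable.iSup fun _ => ?_
  exact ((Finset.measurable_sum _ fun k _ => hX k).abs.div_const _).ennreal_ofReal

theorem lintegral_lilMaximal_rpow_le {T : Ω → Ω} (hT : MeasurePreserving T μ μ) (hm : m ≤ mΩ)
    (hmT : m ≤ m.comap T) {D : Ω → ℝ} (hD : Measurable[m.comap T] D) (hD2 : MemLp D 2 μ)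
    (hD0 : μ[D | m] =ᵐ[μ] 0) (hD1 : ∫ x, D x ^ 2 ∂μ ≤ 1) {p : ℝ} (hp : 1 ≤ p) (hp2 : p < 2) :
    ∫⁻ x, lilMaximal (fun n x => D (T^[n] x)) x ^ p ∂μ ≤ ENNReal.ofReal (momentConst p) := by
  have hDm : Measurable D := hD.mono ((MeasurableSpace.comap_mono hm).trans
    hT.measurable.comap_le) le_rfl
  have hZm : Measurable (lilMaximal (fun n x => D (T^[n] x))) :=
    measurable_lilMaximal fun n => hDm.comp (hT.measurable.iterate n)
  set Z := lilMaximal (fun n x => D (T^[n] x)) with hZ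
  have hset : ∀ i : ℕ, MeasurableSet {y : ℝ≥0∞ | ENNReal.ofReal (2 ^ i) < y} := fun i =>
    measurableSet_Ioi
  refine (lintegral_mono fun x => rpow_le_one_add_tsum_indicator hp (Z x)).trans ?_
  rw [lintegral_add_left measurable_const, lintegral_const, measure_univ, mul_one,
    lintegral_tsum (f := fun (i : ℕ) x => ENNReal.ofReal ((2 : ℝ) ^ p * ((2 : ℝ) ^ p) ^ i) *
      Set.indicator {y | ENNReal.ofReal (2 ^ i) < y} 1 (Z x)) fun i =>
      (((measurable_one.indicator (hset i)).comp hZm).const_mul _).aemeasurable]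
  have hterm : ∀ i : ℕ, ∫⁻ x, ENNReal.ofReal ((2 : ℝ) ^ p * ((2 : ℝ) ^ p) ^ i) *
      Set.indicator {y | ENNReal.ofReal (2 ^ i) < y} 1 (Z x) ∂μ ≤
      ENNReal.ofReal (((2 : ℝ) ^ p * ((2 : ℝ) ^ p) ^ i) * (2 / ((2 : ℝ) ^ ((p + 2) / 2)) ^ i +
        tailConst * Real.exp (-(((2 : ℝ) ^ ((2 - p) / 2)) ^ i / 16)))) := by
    intro i
    rw [lintegral_const_mul _ (f := fun x => Set.indicator {y | ENNReal.ofReal (2 ^ i) < y} 1 (Z x))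
      ((measurable_one.indicator (hset i)).comp hZm),
      ENNReal.ofReal_mul (p := (2 : ℝ) ^ p * ((2 : ℝ) ^ p) ^ i) (by positivity)]
    refine mul_le_mul' le_rfl ?_
    have h1 : ∫⁻ x, Set.indicator {y | ENNReal.ofReal (2 ^ i) < y} 1 (Z x) ∂μ =
        μ {x | ENNReal.ofReal (2 ^ i) < Z x} := by
      exact lintegral_indicator_one (hZm (hset i))
    rw [h1]
    refine (lilMaximal_tail hT hm hmT hD hD2 hD0 hD1 (t := 2 ^ i)
      (s := ((2 : ℝ) ^ ((p + 2) / 2)) ^ i) (by positivity) (by positivity)).trans (le_of_eq ?_)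
    congr 5
    rw [mul_comm, ← div_div, ← pow_mul, mul_comm i 2, pow_mul, ← div_pow]
    congr 2
    rw [← Real.rpow_natCast, ← Real.rpow_sub zero_lt_two]
    congr 1
    push_cast; ring
  refine (add_le_add le_rfl (ENNReal.tsum_le_tsum hterm)).trans ?_
  have := tailConst_nonneg
  rw [← ENNReal.ofReal_tsum_of_nonneg (fun i => by positivity) (summable_momentConst hp2),
    ← ENNReal.ofReal_one, ← ENNReal.ofReal_add zero_le_one (tsum_nonneg fun i => by positivity)]
  rfl

/-- The constant of the maximal inequality in `L^p`. -/
def maxConst (p : ℝ) : ℝ := momentConst p ^ (1 / p)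

theorem maxConst_pos (p : ℝ) : 0 < maxConst p :=
  Real.rpow_pos_of_pos (zero_lt_one.trans_le one_le_momentConst) _

theorem eLpNorm_lilMaximal_le {T : Ω → Ω} (hT : MeasurePreserving T μ μ) (hm : m ≤ mΩ)
    (hmT : m ≤ m.comap T) {D : Ω → ℝ} (hD : Measurable[m.comap T] D) (hD2 : MemLp D 2 μ)
    (hD0 : μ[D | m] =ᵐ[μ] 0) {p : ℝ} (hp : 1 ≤ p) (hp2 : p < 2) :
    eLpNorm (lilMaximal (fun n x => D (T^[n] x))) (ENNReal.ofReal p) μ ≤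
      ENNReal.ofReal (maxConst p) * eLpNorm D 2 μ := by
  have hp0 : 0 < p := by linarith
  have hnorm : ∀ Z : Ω → ℝ≥0∞, eLpNorm Z (ENNReal.ofReal p) μ = (∫⁻ x, Z x ^ p ∂μ) ^ (1 / p) := by
    intro Z
    rw [eLpNorm_eq_lintegral_rpow_enorm_toReal (by simpa using hp0) ENNReal.ofReal_ne_top,
      ENNReal.toReal_ofReal hp0.le]
    rfl
  set s := (eLpNorm D 2 μ).toReal with hs
  have hsD : eLpNorm D 2 μ = ENNReal.ofReal s := (ENNReal.ofReal_toReal hD2.eLpNorm_lt_top.ne).symm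
  have hDsq : ∫ x, D x ^ 2 ∂μ = s ^ 2 := integral_sq_eq_eLpNorm_sq hD2
  have hscale : ∀ c : ℝ, s < c → eLpNorm (lilMaximal (fun n x => D (T^[n] x)))
      (ENNReal.ofReal p) μ ≤ ENNReal.ofReal (maxConst p) * ENNReal.ofReal c := by
    intro c hc
    have hc0 : 0 < c := ENNReal.toReal_nonneg.trans_lt hc
    have h1 := lintegral_lilMaximal_rpow_le hT hm hmT (D := fun x => c⁻¹ * D x) (hD.const_mul _)
      (hD2.const_mul _) (by
        filter_upwards [condExp_smul (μ := μ) c⁻¹ D m, hD0] with x hx hx'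
        exact hx.trans (by simp [hx'])) (by
        simp_rw [mul_pow]
        rw [integral_const_mul, hDsq, inv_pow, inv_mul_le_iff₀ (by positivity), mul_one]
        exact pow_le_pow_left₀ ENNReal.toReal_nonneg hc.le 2) hp hp2
    have h2 : ∀ x, lilMaximal (fun n x => D (T^[n] x)) x =
        ENNReal.ofReal c * lilMaximal (fun n x => c⁻¹ * D (T^[n] x)) x := by
      intro x
      simp only [lilMaximal, ENNReal.mul_iSup, partialSum]
      refine iSup_congr fun n => iSup_congr fun _ => ?_
      rw [← ENNReal.ofReal_mul hc0.le, ← Finset.mul_sum, abs_mul, abs_of_pos (inv_pos.2 hc0)]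
      congr 1
      field_simp
    have h3 : (lilMaximal (fun n x => D (T^[n] x))) =
        fun x => ENNReal.ofReal c * lilMaximal (fun n x => c⁻¹ * D (T^[n] x)) x := funext h2
    rw [h3, hnorm]
    simp_rw [ENNReal.mul_rpow_of_nonneg _ _ hp0.le]
    rw [lintegral_const_mul' _ _ (ENNReal.rpow_ne_top_of_nonneg hp0.le ENNReal.ofReal_ne_top),
      ENNReal.mul_rpow_of_nonneg _ _ (by positivity), ← ENNReal.rpow_mul,
      mul_one_div_cancel hp0.ne', ENNReal.rpow_one, mul_comm]
    refine mul_le_mul' ?_ le_rfl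
    refine (ENNReal.rpow_le_rpow h1 (by positivity)).trans (le_of_eq ?_)
    rw [ENNReal.ofReal_rpow_of_nonneg (zero_le_one.trans one_le_momentConst) (by positivity)]
    rfl
  rw [hsD]
  have hlim : Tendsto (fun c => ENNReal.ofReal (maxConst p) * ENNReal.ofReal c) (𝓝[>] s)
      (𝓝 (ENNReal.ofReal (maxConst p) * ENNReal.ofReal s)) :=
    (ENNReal.Tendsto.const_mul (ENNReal.tendsto_ofReal tendsto_id)
      (Or.inr ENNReal.ofReal_ne_top)).mono_left nhdsWithin_le_nhds
  exact ge_of_tendsto hlim (eventually_mem_nhdsWithin.mono fun c hc => hscale c hc)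

end Stationary

section Pointwise

variable {Ω : Type*} {ι : Type*}

theorem enorm_partialSum_div (X : ℕ → Ω → ℝ) (n : ℕ) (x : Ω) :
    ENNReal.ofReal (|partialSum X n x| / lilNorm n) = ‖partialSum X n x / lilNorm n‖ₑ := by
  rw [Real.enorm_eq_ofReal_abs, abs_div, abs_of_nonneg (lilNorm_nonneg n)]

theorem enorm_partialSum_div_le_lilMaximal (X : ℕ → Ω → ℝ) (n : ℕ) (x : Ω) :
    ‖partialSum X n x / lilNorm n‖ₑ ≤ lilMaximal X x := by
  rw [← enorm_partialSum_div]
  rcases Nat.eq_zero_or_pos n with rfl | hn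
  · simp [partialSum]
  · exact le_iSup₂_of_le n hn le_rfl

theorem lilMaximal_le_of_forall {X : ℕ → Ω → ℝ} {x : Ω} {c : ℝ≥0∞}
    (h : ∀ n, ‖partialSum X n x / lilNorm n‖ₑ ≤ c) : lilMaximal X x ≤ c := by
  refine iSup₂_le fun n _ => ?_
  rw [enorm_partialSum_div]
  exact h n

theorem hasSum_partialSum {Z : ι → ℕ → Ω → ℝ} {X : ℕ → Ω → ℝ} {x : Ω}
    (h : ∀ n, HasSum (fun k => Z k n x) (X n x)) (n : ℕ) :
    HasSum (fun k => partialSum (Z k) n x) (partialSum X n x) :=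
  hasSum_sum fun i _ => h i

theorem lilMaximal_le_tsum {Z : ι → ℕ → Ω → ℝ} {X : ℕ → Ω → ℝ} {x : Ω}
    (h : ∀ n, HasSum (fun k => Z k n x) (X n x)) :
    lilMaximal X x ≤ ∑' k, lilMaximal (Z k) x := by
  refine lilMaximal_le_of_forall fun n => ?_
  rw [← ((hasSum_partialSum h n).div_const (lilNorm n)).tsum_eq]
  exact enorm_tsum_le_tsum_enorm.trans
    (ENNReal.tsum_le_tsum fun k => enorm_partialSum_div_le_lilMaximal _ _ _)

theorem lilMaximal_sub_le (X Y : ℕ → Ω → ℝ) (x : Ω) :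
    lilMaximal (fun n => X n - Y n) x ≤ lilMaximal X x + lilMaximal Y x := by
  refine lilMaximal_le_of_forall fun n => ?_
  have : partialSum (fun n => X n - Y n) n x = partialSum X n x - partialSum Y n x := by
    simp [partialSum]
  rw [this, sub_div]
  exact (enorm_sub_le).trans (add_le_add (enorm_partialSum_div_le_lilMaximal _ _ _)
    (enorm_partialSum_div_le_lilMaximal _ _ _))

/-- Dominated convergence for series of processes whose maximal functions are summable. -/
theorem isLittleO_partialSum_of_hasSum {E : ι → ℕ → Ω → ℝ} {R : ℕ → Ω → ℝ} {x : Ω}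
    (h : ∀ n, HasSum (fun k => E k n x) (R n x))
    (hE : ∀ k, (fun n : ℕ => partialSum (E k) n x) =o[atTop] lilNorm)
    (hfin : ∑' k, lilMaximal (E k) x ≠ ∞) :
    (fun n : ℕ => partialSum R n x) =o[atTop] lilNorm := by
  have hpos : ∀ᶠ n in atTop, lilNorm n = 0 → partialSum R n x = 0 := by
    filter_upwards [eventually_ge_atTop 1] with n hn h0
    exact absurd h0 (lilNorm_pos hn).ne'
  rw [isLittleO_iff_tendsto' hpos]
  have key := tendsto_tsum_of_dominated_convergence (𝓕 := atTop)
    (f := fun (n : ℕ) k => partialSum (E k) n x / lilNorm n) (g := fun _ => (0 : ℝ))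
    (bound := fun k => (lilMaximal (E k) x).toReal) (ENNReal.summable_toReal hfin)
    (fun k => (hE k).tendsto_div_nhds_zero) (Eventually.of_forall fun n k => by
      rw [← toReal_enorm]
      exact ENNReal.toReal_mono (ENNReal.ne_top_of_tsum_ne_top hfin k)
        (enorm_partialSum_div_le_lilMaximal _ _ _))
  simp only [tsum_zero] at key
  refine key.congr fun n => ?_
  exact ((hasSum_partialSum h n).div_const (lilNorm n)).tsum_eq

theorem isLittleO_sum_shift_sub {c : ℤ → ℝ} {l : ℕ → ℝ} (hl : Tendsto l atTop atTop)
    (hc : ∀ m : ℤ, (fun n : ℕ => c (n + m)) =o[atTop] l) (m : ℤ) :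
    (fun n : ℕ => ∑ i ∈ Finset.range n, (c (i + m) - c i)) =o[atTop] l := by
  have hconst : ∀ a : ℝ, (fun _ : ℕ => a) =o[atTop] l := fun a =>
    isLittleO_const_left.2 (Or.inr (tendsto_norm_atTop_atTop.comp hl))
  have hstep : ∀ m : ℤ, (fun n : ℕ => ∑ i ∈ Finset.range n, (c (i + (m + 1)) - c (i + m)))
      =o[atTop] l := by
    intro m
    have : (fun n : ℕ => ∑ i ∈ Finset.range n, (c (i + (m + 1)) - c (i + m))) =
        fun n : ℕ => c (n + m) - c m := by
      funext n
      have := Finset.sum_range_sub (fun i : ℕ => c (i + m)) n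
      simp only [Nat.cast_add, Nat.cast_one, Nat.cast_zero, zero_add] at this
      rw [← this]
      refine Finset.sum_congr rfl fun i _ => ?_
      rw [add_right_comm, add_assoc]
    rw [this]
    exact (hc m).sub (hconst _)
  induction m using Int.induction_on with
  | zero => simp
  | succ m ih =>
    refine (ih.add (hstep m)).congr_left fun n => ?_
    rw [← Finset.sum_add_distrib]
    refine Finset.sum_congr rfl fun i _ => by ring
  | pred m ih =>
    refine (ih.sub (hstep (-m - 1))).congr_left fun n => ?_
    rw [← Finset.sum_sub_distrib]
    refine Finset.sum_congr rfl fun i _ => ?_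
    rw [sub_add_cancel]
    ring

end Pointwise

section Moments

variable {Ω : Type*} {mΩ : MeasurableSpace Ω} {μ : Measure Ω}

theorem eLpNorm_ofReal_eq {p : ℝ} (hp : 0 < p) (Z : Ω → ℝ≥0∞) :
    eLpNorm Z (ENNReal.ofReal p) μ = (∫⁻ x, Z x ^ p ∂μ) ^ (1 / p) := by
  rw [eLpNorm_eq_lintegral_rpow_enorm_toReal (by simpa using hp) ENNReal.ofReal_ne_top,
    ENNReal.toReal_ofReal hp.le]
  rfl

/-- Minkowski's inequality for countable sums of nonnegative functions. -/
theorem eLpNorm_tsum_le {ι : Type*} [Countable ι] {p : ℝ} (hp : 1 ≤ p) {Z : ι → Ω → ℝ≥0∞}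
    (hZ : ∀ k, AEMeasurable (Z k) μ) :
    eLpNorm (fun x => ∑' k, Z k x) (ENNReal.ofReal p) μ ≤
      ∑' k, eLpNorm (Z k) (ENNReal.ofReal p) μ := by
  have hp0 : 0 < p := by linarith
  rw [eLpNorm_ofReal_eq hp0]
  have h1 : ∀ x, (∑' k, Z k x) ^ p = ⨆ s : Finset ι, (∑ k ∈ s, Z k x) ^ p := fun x => by
    rw [ENNReal.tsum_eq_iSup_sum]
    exact (ENNReal.orderIsoRpow p hp0).map_iSup _
  simp_rw [h1]
  rw [lintegral_iSup_directed]
  rotate_left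
  · exact fun s => (Finset.aemeasurable_fun_sum s fun k _ => hZ k).pow_const p
  · classical
    intro s t
    refine ⟨s ∪ t, fun x => ?_, fun x => ?_⟩
    · exact ENNReal.rpow_le_rpow (Finset.sum_le_sum_of_subset Finset.subset_union_left) hp0.le
    · exact ENNReal.rpow_le_rpow (Finset.sum_le_sum_of_subset Finset.subset_union_right) hp0.le
  rw [show (⨆ s : Finset ι, ∫⁻ x, (∑ k ∈ s, Z k x) ^ p ∂μ) ^ (1 / p) =
      ⨆ s : Finset ι, (∫⁻ x, (∑ k ∈ s, Z k x) ^ p ∂μ) ^ (1 / p) from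
    (ENNReal.orderIsoRpow (1 / p) (by positivity)).map_iSup _]
  refine iSup_le fun s => ?_
  rw [← eLpNorm_ofReal_eq hp0 (fun x => ∑ k ∈ s, Z k x)]
  have h2 := eLpNorm_sum_le (μ := μ) (p := ENNReal.ofReal p) (f := Z) (s := s)
    (fun k _ => (hZ k).aestronglyMeasurable) (ENNReal.one_le_ofReal.2 hp)
  refine le_trans (le_of_eq ?_) (h2.trans (ENNReal.sum_le_tsum s))
  congr 1
  ext x
  simp

theorem weakNorm_le_eLpNorm {p : ℝ} (hp : 0 < p) {Z : Ω → ℝ≥0∞} (hZ : AEMeasurable Z μ) :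
    weakNorm μ p Z ≤ eLpNorm Z (ENNReal.ofReal p) μ := by
  refine iSup₂_le fun t ht => ?_
  rw [eLpNorm_ofReal_eq hp]
  have h1 := mul_meas_ge_le_lintegral₀ (hZ.pow_const p) (ENNReal.ofReal t ^ p)
  calc ENNReal.ofReal t * μ {ω | ENNReal.ofReal t < Z ω} ^ (1 / p)
      = (ENNReal.ofReal t ^ p * μ {ω | ENNReal.ofReal t < Z ω}) ^ (1 / p) := by
        rw [ENNReal.mul_rpow_of_nonneg _ _ (by positivity), ← ENNReal.rpow_mul,
          mul_one_div_cancel hp.ne', ENNReal.rpow_one]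
    _ ≤ _ := by
        refine ENNReal.rpow_le_rpow (le_trans (mul_le_mul' le_rfl (measure_mono ?_)) h1)
          (by positivity)
        intro ω hω
        exact ENNReal.rpow_le_rpow (le_of_lt hω) hp.le

theorem ae_isLittleO_sqrt [IsProbabilityMeasure μ] {T : Ω → Ω} (hT : MeasurePreserving T μ μ)
    {h : Ω → ℝ} (h2 : MemLp h 2 μ) :
    ∀ᵐ x ∂μ, (fun n : ℕ => h (T^[n] x)) =o[atTop] fun n : ℕ => √(n : ℝ) := by
  have hk : ∀ k : ℕ, ∀ᵐ x ∂μ, ∀ᶠ n : ℕ in atTop, ((k + 1 : ℝ) * h (T^[n] x)) ^ 2 ≤ n := by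
    intro k
    let _ : MeasureSpace Ω := ⟨μ⟩
    have hfin := tsum_prob_mem_Ioi_lt_top (X := fun x => ((k + 1 : ℝ) * h x) ^ 2)
      ((h2.const_mul _).integrable_sq) (fun x => sq_nonneg _)
    have hfin' : ∑' n : ℕ, μ {x | (n : ℝ) < ((k + 1 : ℝ) * h (T^[n] x)) ^ 2} ≠ ∞ := by
      refine ne_of_lt (lt_of_le_of_lt (ENNReal.tsum_le_tsum fun n => ?_) hfin)
      exact (hT.iterate n).measure_preimage_le {x | ((k + 1 : ℝ) * h x) ^ 2 ∈ Set.Ioi (n : ℝ)}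
    filter_upwards [ae_eventually_notMem hfin'] with x hx
    filter_upwards [hx] with n hn
    exact not_lt.1 hn
  filter_upwards [ae_all_iff.2 hk] with x hx
  refine isLittleO_iff.2 fun c hc => ?_
  obtain ⟨k, hk⟩ := exists_nat_one_div_lt hc
  filter_upwards [hx k] with n hn
  rw [Real.norm_eq_abs, Real.norm_eq_abs, abs_of_nonneg (Real.sqrt_nonneg _)]
  have h1 : (k + 1 : ℝ) * |h (T^[n] x)| ≤ √n := by
    refine Real.le_sqrt_of_sq_le ?_
    rwa [mul_pow, sq_abs, ← mul_pow]
  have hk1 : (0 : ℝ) < k + 1 := by positivity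
  calc |h (T^[n] x)| = 1 / (k + 1 : ℝ) * ((k + 1 : ℝ) * |h (T^[n] x)|) := by field_simp
    _ ≤ c * √n := mul_le_mul hk.le h1 (by positivity) hc.le

theorem ae_hasSum_of_tendsto_eLpNorm {ι : Type*} [Countable ι]
    {p : ι → Ω → ℝ} {X : Ω → ℝ} (hp : ∀ k, AEStronglyMeasurable (p k) μ)
    (hX : AEStronglyMeasurable X μ) (hfin : ∑' k, eLpNorm (p k) 2 μ ≠ ∞)
    {s : ℕ → Finset ι} (hs : Tendsto s atTop atTop)
    (hlim : Tendsto (fun n => eLpNorm (∑ k ∈ s n, p k - X) 2 μ) atTop (𝓝 0)) :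
    ∀ᵐ x ∂μ, HasSum (fun k => p k x) (X x) := by
  have h1 := summable_norm_of_tsum_eLpNorm_ne_top (by norm_num) hp hfin
  have h2 := tendstoInMeasure_of_tendsto_eLpNorm two_ne_zero
    (fun n => Finset.aestronglyMeasurable_sum (s n) fun k _ => hp k) hX hlim
  obtain ⟨ns, hns, h3⟩ := h2.exists_seq_tendsto_ae
  filter_upwards [h1, h3] with x h1 h3
  have h4 := h1.of_norm.hasSum
  have h5 : Tendsto (fun i => ∑ k ∈ s (ns i), p k x) atTop (𝓝 (∑' k, p k x)) :=
    h4.comp (hs.comp hns.tendsto_atTop)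
  simp only [Finset.sum_apply] at h3
  rw [tendsto_nhds_unique h3 h5]
  exact h4

theorem tendsto_eLpNorm_sub_sum {ι : Type*} [Countable ι]
    {p : ι → Ω → ℝ} {X : Ω → ℝ} (hp : ∀ k, AEStronglyMeasurable (p k) μ)
    (hfin : ∑' k, eLpNorm (p k) 2 μ ≠ ∞) (h : ∀ᵐ x ∂μ, HasSum (fun k => p k x) (X x)) :
    Tendsto (fun s : Finset ι => eLpNorm (X - ∑ k ∈ s, p k) 2 μ) atTop (𝓝 0) := by
  refine tendsto_of_tendsto_of_tendsto_of_le_of_le tendsto_const_nhds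
    (ENNReal.tendsto_tsum_compl_atTop_zero hfin) (fun _ => zero_le) fun s => ?_
  have h1 : ∀ᵐ x ∂μ, ‖(X - ∑ k ∈ s, p k) x‖ₑ ≤ ‖∑' k : {k // k ∉ s}, ‖p k x‖ₑ‖ₑ := by
    filter_upwards [h] with x hx
    have h2 := (Finset.hasSum_compl_iff s (f := fun k => p k x)
      (a := X x - ∑ k ∈ s, p k x)).2 (by simpa using hx)
    rw [Pi.sub_apply, Finset.sum_apply, ← h2.tsum_eq]
    exact enorm_tsum_le_tsum_enorm
  refine (eLpNorm_mono_enorm_ae h1).trans ?_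
  have h2 := eLpNorm_tsum_le (μ := μ) (p := 2) one_le_two
    (Z := fun (k : {k // k ∉ s}) x => ‖p k x‖ₑ) fun k => (hp k).enorm
  rw [ENNReal.ofReal_ofNat] at h2
  simpa only [eLpNorm_enorm] using h2

end Moments

theorem measurable_real_tsum {Ω ι : Type*} [Countable ι] {m : MeasurableSpace Ω} {f : ι → Ω → ℝ}
    (hf : ∀ i, Measurable (f i)) : Measurable fun x => ∑' i, f i x :=
  Measurable.tsum hf

section Projections

variable {Ω : Type*} {mΩ : MeasurableSpace Ω} {μ : Measure Ω} {ξ : ℤ → Ω → ℝ}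

theorem pastSigma_mono (ξ : ℤ → Ω → ℝ) : Monotone (pastSigma ξ) := fun _ _ h =>
  iSup_mono fun _ => iSup_mono' fun hj => ⟨hj.trans h, le_rfl⟩

theorem pastSigma_le (hξ : ∀ n, Measurable (ξ n)) (n : ℤ) : pastSigma ξ n ≤ mΩ :=
  iSup₂_le fun j _ => (hξ j).comap_le

theorem stronglyMeasurable_martProj (μ : Measure Ω) (ξ : ℤ → Ω → ℝ) (n : ℤ) (Z : Ω → ℝ) :
    StronglyMeasurable[pastSigma ξ n] (martProj μ ξ n Z) :=
  stronglyMeasurable_condExp.sub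
    (stronglyMeasurable_condExp.mono (pastSigma_mono ξ (by lia)))

theorem memLp_martProj (n : ℤ) {Z : Ω → ℝ} (hZ : MemLp Z 2 μ) : MemLp (martProj μ ξ n Z) 2 μ :=
  (hZ.condExp (by norm_num)).sub (hZ.condExp (by norm_num))

theorem condExp_martProj [IsFiniteMeasure μ] (hξ : ∀ n, Measurable (ξ n)) (n : ℤ) (Z : Ω → ℝ) :
    μ[martProj μ ξ n Z | pastSigma ξ (n - 1)] =ᵐ[μ] 0 := by
  have h1 := condExp_sub (μ := μ) (f := μ[Z | pastSigma ξ n]) (g := μ[Z | pastSigma ξ (n - 1)])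
    integrable_condExp integrable_condExp (pastSigma ξ (n - 1))
  have h2 := condExp_condExp_of_le (μ := μ) (f := Z)
    (pastSigma_mono ξ (by lia : n - 1 ≤ n)) (pastSigma_le hξ n)
  have h3 := condExp_condExp_of_le (μ := μ) (f := Z) le_rfl (pastSigma_le hξ (n - 1))
  filter_upwards [h1, h2, h3] with x h1 h2 h3
  refine h1.trans ?_
  rw [Pi.sub_apply, h2, h3, sub_self, Pi.zero_apply]

theorem pastSigma_comap {Ω' : Type*} (π : Ω → Ω') (ζ : ℤ → Ω' → ℝ) (n k : ℤ)
    (h : ∀ j, ζ j ∘ π = ξ (j + k)) :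
    (pastSigma ζ n).comap π = pastSigma ξ (n + k) := by
  simp only [pastSigma, MeasurableSpace.comap_iSup, MeasurableSpace.comap_comp, h]
  refine le_antisymm (iSup₂_le fun j hj => le_iSup₂_of_le (j + k) (by lia) le_rfl)
    (iSup₂_le fun j hj => le_iSup₂_of_le (j - k) (by lia) ?_)
  rw [sub_add_cancel]

theorem martProj_comp {Ω' : Type*} {mΩ' : MeasurableSpace Ω'} [IsFiniteMeasure μ] {ν : Measure Ω'}
    [IsFiniteMeasure ν] {π : Ω → Ω'} (hπ : MeasurePreserving π μ ν) {ζ : ℤ → Ω' → ℝ}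
    (hζ : ∀ n, Measurable (ζ n)) {k : ℤ} (h : ∀ j, ζ j ∘ π = ξ (j + k)) (n : ℤ) {Z : Ω' → ℝ}
    (hZ : Integrable Z ν) :
    martProj μ ξ (n + k) (Z ∘ π) =ᵐ[μ] martProj ν ζ n Z ∘ π := by
  have h1 := condExp_comp_measurePreserving hπ (pastSigma_le hζ n) hZ
  have h2 := condExp_comp_measurePreserving hπ (pastSigma_le hζ (n - 1)) hZ
  rw [pastSigma_comap π ζ _ _ h] at h1 h2
  rw [show n - 1 + k = n + k - 1 by ring] at h2
  filter_upwards [h1, h2] with x h1 h2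
  simp only [martProj, Pi.sub_apply, Function.comp_apply] at h1 h2 ⊢
  rw [h1, h2]

theorem sum_martProj_Ioc (μ : Measure Ω) (ξ : ℤ → Ω → ℝ) (Z : Ω → ℝ) (a : ℤ) (n : ℕ) :
    ∑ k ∈ Finset.Ioc a (a + n), martProj μ ξ k Z =
      μ[Z | pastSigma ξ (a + n)] - μ[Z | pastSigma ξ a] := by
  induction n with
  | zero => simp
  | succ n ih =>
    have h1 : Finset.Ioc a (a + (n + 1 : ℕ)) = insert (a + n + 1) (Finset.Ioc a (a + n)) := by
      ext j; simp only [Finset.mem_Ioc, Finset.mem_insert]; push_cast; lia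
    rw [h1, Finset.sum_insert (by simp), ih, martProj, add_sub_cancel_right]
    push_cast
    rw [← add_assoc]
    abel

end Projections

section Canonical

/-- The coordinate process on the space of two-sided sequences. -/
def coord (j : ℤ) (x : ℤ → ℝ) : ℝ := x j

/-- The powers of the shift on two-sided sequences. -/
def shiftSeq (k : ℤ) (x : ℤ → ℝ) : ℤ → ℝ := fun j => x (j + k)

theorem measurable_coord (j : ℤ) : Measurable (coord j) := measurable_pi_apply j

theorem measurable_shiftSeq (k : ℤ) : Measurable (shiftSeq k) :=
  measurable_pi_lambda _ fun j => measurable_pi_apply (j + k)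

theorem shiftSeq_shiftSeq (k l : ℤ) (x : ℤ → ℝ) : shiftSeq k (shiftSeq l x) = shiftSeq (k + l) x :=
  funext fun j => by simp [shiftSeq, add_assoc]

theorem shiftSeq_zero (x : ℤ → ℝ) : shiftSeq 0 x = x := funext fun j => by simp [shiftSeq]

theorem iterate_shiftSeq (n : ℕ) (x : ℤ → ℝ) : (shiftSeq 1)^[n] x = shiftSeq n x := by
  induction n with
  | zero => simp [shiftSeq_zero]
  | succ n ih =>
    rw [Function.iterate_succ_apply', ih, shiftSeq_shiftSeq, add_comm]
    norm_cast

theorem comap_shiftSeq (n k : ℤ) :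
    (pastSigma coord n).comap (shiftSeq k) = pastSigma coord (n + k) :=
  pastSigma_comap _ _ _ _ fun _ => rfl

variable {P : Measure (ℤ → ℝ)} [IsProbabilityMeasure P]

theorem martProj_shiftSeq (hP : ∀ k, MeasurePreserving (shiftSeq k) P P) (n k : ℤ)
    {Z : (ℤ → ℝ) → ℝ} (hZ : Integrable Z P) :
    martProj P coord (n + k) (fun x => Z (shiftSeq k x)) =ᵐ[P]
      fun x => martProj P coord n Z (shiftSeq k x) :=
  martProj_comp (hP k) measurable_coord (fun _ => rfl) n hZ

theorem eLpNorm_lilMaximal_martProj_le (hP : ∀ k, MeasurePreserving (shiftSeq k) P P) (n l : ℤ)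
    {Z : (ℤ → ℝ) → ℝ} (hZ : MemLp Z 2 P) {p : ℝ} (hp : 1 ≤ p) (hp2 : p < 2) :
    eLpNorm (lilMaximal fun (i : ℕ) x => martProj P coord n Z (shiftSeq (i + l) x))
      (ENNReal.ofReal p) P ≤
      ENNReal.ofReal (maxConst p) * eLpNorm (martProj P coord n Z) 2 P := by
  set e := martProj P coord n Z with he
  have hem : Measurable e := ((stronglyMeasurable_martProj P coord n Z).mono
    (pastSigma_le measurable_coord n)).measurable
  have hcomap : (pastSigma coord (n - 1)).comap (shiftSeq 1) = pastSigma coord n := by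
    rw [comap_shiftSeq, sub_add_cancel]
  have h1 := eLpNorm_lilMaximal_le (m := pastSigma coord (n - 1)) (hP 1)
    (pastSigma_le measurable_coord _) (by
      rw [hcomap]; exact pastSigma_mono coord (by lia)) (D := e) (by
      rw [hcomap]; exact (stronglyMeasurable_martProj P coord n Z).measurable)
    (memLp_martProj n hZ) (condExp_martProj measurable_coord n Z) hp hp2
  simp only [iterate_shiftSeq] at h1
  have h2 : (lilMaximal fun (i : ℕ) x => e (shiftSeq (i + l) x)) =
      (lilMaximal fun (i : ℕ) x => e (shiftSeq i x)) ∘ shiftSeq l := by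
    ext x
    simp [lilMaximal, partialSum, shiftSeq_shiftSeq]
  have h3 : Measurable (lilMaximal fun (i : ℕ) x => e (shiftSeq i x)) :=
    measurable_lilMaximal fun i => hem.comp (measurable_shiftSeq i)
  rw [h2, eLpNorm_comp_measurePreserving h3.aemeasurable.aestronglyMeasurable (hP l)]
  exact h1

/-- A Hannan-type theorem for stationary sequences on the space of two-sided sequences. -/
theorem hannanConclusion_of_stationary (hP : ∀ k, MeasurePreserving (shiftSeq k) P P)
    {Z : (ℤ → ℝ) → ℝ} (hZm : Measurable Z) (hZ : MemLp Z 2 P)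
    (hfin : hannanNorm P coord Z < ∞)
    (hpast : Tendsto (fun n : ℕ => eLpNorm (P[Z | pastSigma coord (-n)]) 2 P) atTop (𝓝 0))
    (hfuture : Tendsto (fun n : ℕ => eLpNorm (P[Z | pastSigma coord n] - Z) 2 P) atTop (𝓝 0)) :
    HannanConclusion maxConst P coord (fun n x => Z (shiftSeq n x)) := by
  have hX0 : (fun x => Z (shiftSeq 0 x)) = Z := funext fun x => by rw [shiftSeq_zero]
  have hZi : Integrable Z P := hZ.integrable (by norm_num)
  have hmeas : ∀ (n : ℤ) (Y : (ℤ → ℝ) → ℝ), Measurable (martProj P coord n Y) := fun n Y =>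
    ((stronglyMeasurable_martProj P coord n Y).mono (pastSigma_le measurable_coord n)).measurable
  have hsumZ : ∀ᵐ x ∂P, HasSum (fun k => martProj P coord k Z x) (Z x) := by
    refine ae_hasSum_of_tendsto_eLpNorm (fun k => (hmeas k Z).aestronglyMeasurable)
      hZm.aestronglyMeasurable hfin.ne Finset.tendsto_Ioc_neg ?_
    have h1 : ∀ n : ℕ, ∑ k ∈ Finset.Ioc (-n : ℤ) n, martProj P coord k Z - Z =
        (P[Z | pastSigma coord n] - Z) - P[Z | pastSigma coord (-n)] := by
      intro n
      have := sum_martProj_Ioc P coord Z (-n) (2 * n)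
      rw [show (-n : ℤ) + (2 * n : ℕ) = n by push_cast; ring] at this
      rw [this]
      abel
    simp_rw [h1]
    refine tendsto_of_tendsto_of_tendsto_of_le_of_le tendsto_const_nhds
      (by simpa using hfuture.add hpast) (fun _ => zero_le) fun n => ?_
    exact eLpNorm_sub_le (integrable_condExp.aestronglyMeasurable.sub hZm.aestronglyMeasurable)
      integrable_condExp.aestronglyMeasurable (by norm_num)
  set e : ℤ → (ℤ → ℝ) → ℝ := fun m => martProj P coord 1 (fun x => Z (shiftSeq m x)) with he
  have hXm : ∀ m, MemLp (fun x => Z (shiftSeq m x)) 2 P := fun m =>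
    hZ.comp_measurePreserving (hP m)
  have hee : ∀ m, e m =ᵐ[P] fun x => martProj P coord (1 - m) Z (shiftSeq m x) := fun m => by
    have := martProj_shiftSeq hP (1 - m) m hZi
    rwa [sub_add_cancel] at this
  have henorm : ∀ m, eLpNorm (e m) 2 P = eLpNorm (martProj P coord (1 - m) Z) 2 P := fun m => by
    rw [eLpNorm_congr_ae (hee m)]
    exact eLpNorm_comp_measurePreserving (hmeas _ _).aestronglyMeasurable (hP m)
  have hesum : ∑' m, eLpNorm (e m) 2 P = hannanNorm P coord Z := by
    simp_rw [henorm]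
    exact (Equiv.subLeft (1 : ℤ)).tsum_eq fun k => eLpNorm (martProj P coord k Z) 2 P
  have hefin : ∑' m, eLpNorm (e m) 2 P ≠ ∞ := hesum ▸ hfin.ne
  have hem : ∀ m, Measurable (e m) := fun m => hmeas _ _
  have hsum1 := summable_norm_of_tsum_eLpNorm_ne_top (by norm_num : (1 : ℝ≥0∞) ≤ 2)
    (fun m => (hem m).aestronglyMeasurable) hefin
  obtain ⟨g, hgm, hge⟩ : ∃ g : (ℤ → ℝ) → ℝ, StronglyMeasurable[pastSigma coord 1] g ∧
      ∀ᵐ x ∂P, HasSum (fun m => e m x) (g x) := by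
    refine ⟨fun x => ∑' m, e m x, Measurable.stronglyMeasurable (measurable_real_tsum fun m =>
      (stronglyMeasurable_martProj P coord 1 _).measurable), ?_⟩
    filter_upwards [hsum1] with x hx using hx.of_norm.hasSum
  have hgm' : Measurable g := (hgm.mono (pastSigma_le measurable_coord 1)).measurable
  have hshift0 : shiftProcess g coord 0 = g := funext fun x => by
    simp only [shiftProcess, coord, Nat.cast_zero, add_zero]
  have hlim := tendsto_eLpNorm_sub_sum (fun m => (hem m).aestronglyMeasurable) hefin hge
  have hgLp : MemLp g 2 P := by
    refine ⟨hgm'.aestronglyMeasurable, ?_⟩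
    have h1 : eLpNorm g 2 P ≤ eLpNorm (fun x => ∑' m, ‖e m x‖ₑ) 2 P := by
      refine eLpNorm_mono_enorm_ae ?_
      filter_upwards [hge] with x hx
      rw [← hx.tsum_eq]
      exact enorm_tsum_le_tsum_enorm
    have h2 := eLpNorm_tsum_le (μ := P) (p := 2) one_le_two
      (Z := fun m x => ‖e m x‖ₑ) fun m => (hem m).enorm.aemeasurable
    rw [ENNReal.ofReal_ofNat] at h2
    simp only [eLpNorm_enorm] at h2
    exact (h1.trans h2).trans_lt hefin.lt_top
  refine ⟨by simpa only [hX0] using hfin, fun p hp hp2 => ?_, g, hgm', ?_, ?_, ?_, ?_, ?_⟩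
  · simp only [hX0]
    have hZs : ∀ n : ℕ, Measurable fun x => Z (shiftSeq n x) := fun n =>
      hZm.comp (measurable_shiftSeq n)
    refine (weakNorm_le_eLpNorm (by linarith) (measurable_lilMaximal hZs).aemeasurable).trans ?_
    have h1 : ∀ᵐ x ∂P, lilMaximal (fun (n : ℕ) x => Z (shiftSeq n x)) x ≤
        ∑' k, lilMaximal (fun (n : ℕ) x => martProj P coord k Z (shiftSeq (n + 0) x)) x := by
      have h2 : ∀ᵐ x ∂P, ∀ n : ℕ, HasSum (fun k => martProj P coord k Z (shiftSeq n x))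
          (Z (shiftSeq n x)) := ae_all_iff.2 fun n =>
        (hP n).quasiMeasurePreserving.ae hsumZ
      filter_upwards [h2] with x hx
      simp only [add_zero]
      exact lilMaximal_le_tsum (Z := fun k (n : ℕ) x => martProj P coord k Z (shiftSeq n x))
        (X := fun (n : ℕ) x => Z (shiftSeq n x)) hx
    refine (eLpNorm_mono_enorm_ae h1).trans ((eLpNorm_tsum_le hp fun k =>
      (measurable_lilMaximal fun n => (hmeas _ _).comp (measurable_shiftSeq _)).aemeasurable).trans
        ?_)
    rw [hannanNorm, ← ENNReal.tsum_mul_left]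
    exact ENNReal.tsum_le_tsum fun k => eLpNorm_lilMaximal_martProj_le hP k 0 hZ hp hp2
  · rw [hshift0]; exact hgm
  · rw [hshift0]; exact hgLp
  · rw [hshift0]; exact hlim
  · rw [hshift0]
    have h1 : ∀ s : Finset ℤ, eLpNorm (P[g | pastSigma coord 0]) 2 P ≤
        eLpNorm (g - ∑ m ∈ s, e m) 2 P := by
      intro s
      have hei : ∀ m, Integrable (e m) P := fun m =>
        (memLp_martProj 1 (hXm m)).integrable (by norm_num)
      have h2 := condExp_sub (hgLp.integrable (by norm_num))
        (integrable_finsetSum' s fun m _ => hei m) (pastSigma coord 0)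
      have h3 := condExp_finsetSum (s := s) (fun m _ => hei m) (pastSigma coord 0)
      have h4 : ∀ᵐ x ∂P, ∀ m, (P[e m | pastSigma coord 0]) x = 0 := ae_all_iff.2 fun m => by
        exact condExp_martProj (μ := P) measurable_coord 1 (fun x => Z (shiftSeq m x))
      have h5 : P[g | pastSigma coord 0] =ᵐ[P] P[g - ∑ m ∈ s, e m | pastSigma coord 0] := by
        filter_upwards [h2, h3, h4] with x h2 h3 h4
        rw [h2, Pi.sub_apply, h3, Finset.sum_apply]
        simp [h4]
      rw [eLpNorm_congr_ae h5]
      exact eLpNorm_condExp_le_eLpNorm _ (by norm_num)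
    have h6 := ge_of_tendsto' hlim h1
    exact (eLpNorm_eq_zero_iff integrable_condExp.aestronglyMeasurable two_ne_zero).1
      (le_antisymm h6 zero_le)
  · set E : ℤ → ℕ → (ℤ → ℝ) → ℝ := fun m n x => e m (shiftSeq (n - m) x) - e m (shiftSeq n x)
      with hE
    have h1 : ∀ᵐ x ∂P, ∀ n : ℕ, HasSum (fun m => E m n x)
        (Z (shiftSeq n x) - g (shiftSeq n x)) := by
      have h2 : ∀ᵐ x ∂P, ∀ n : ℕ, HasSum (fun m => martProj P coord (1 - m) Z (shiftSeq n x))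
          (Z (shiftSeq n x)) := ae_all_iff.2 fun n => by
        filter_upwards [(hP n).quasiMeasurePreserving.ae hsumZ] with x hx
        exact (Equiv.subLeft (1 : ℤ)).hasSum_iff.2 hx
      have h3 : ∀ᵐ x ∂P, ∀ n : ℕ, HasSum (fun m => e m (shiftSeq n x)) (g (shiftSeq n x)) :=
        ae_all_iff.2 fun n => (hP n).quasiMeasurePreserving.ae hge
      have h4 : ∀ᵐ x ∂P, ∀ (n : ℕ) (m : ℤ), e m (shiftSeq (n - m) x) =
          martProj P coord (1 - m) Z (shiftSeq n x) :=
        ae_all_iff.2 fun n => ae_all_iff.2 fun m => by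
          filter_upwards [(hP (n - m)).quasiMeasurePreserving.ae (hee m)] with x hx
          rw [hx, shiftSeq_shiftSeq, add_sub_cancel]
      filter_upwards [h2, h3, h4] with x h2 h3 h4 n
      refine HasSum.sub ?_ (h3 n)
      simpa only [h4] using h2 n
    have h2 : ∀ᵐ x ∂P, ∀ m, (fun n : ℕ => partialSum (E m) n x) =o[atTop] lilNorm := by
      refine ae_all_iff.2 fun m => ?_
      have h3 : ∀ᵐ x ∂P, ∀ l : ℤ, (fun n : ℕ => e m (shiftSeq (n + l) x)) =o[atTop] lilNorm := by
        refine ae_all_iff.2 fun l => ?_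
        have h4 := ae_isLittleO_sqrt (hP 1) (memLp_martProj (ξ := coord) 1 (hXm m))
        filter_upwards [(hP l).quasiMeasurePreserving.ae h4] with x hx
        simp only [iterate_shiftSeq, shiftSeq_shiftSeq] at hx
        refine hx.trans_isBigO (IsBigO.of_bound 1 (Eventually.of_forall fun n => ?_))
        rw [one_mul, Real.norm_of_nonneg (Real.sqrt_nonneg _),
          Real.norm_of_nonneg (lilNorm_nonneg n)]
        exact sqrt_le_lilNorm n
      filter_upwards [h3] with x hx
      have hl : Tendsto lilNorm atTop atTop := tendsto_atTop_mono sqrt_le_lilNorm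
        (Real.tendsto_sqrt_atTop.comp tendsto_natCast_atTop_atTop)
      exact isLittleO_sum_shift_sub hl (c := fun j => e m (shiftSeq j x)) hx (-m)
    have h3 : ∀ᵐ x ∂P, ∑' m, lilMaximal (E m) x ≠ ∞ := by
      have hEm : ∀ m n, Measurable (E m n) := fun m n =>
        ((hem m).comp (measurable_shiftSeq _)).sub ((hem m).comp (measurable_shiftSeq _))
      have h4 : ∀ m, eLpNorm (lilMaximal (E m)) (ENNReal.ofReal 1) P ≤
          2 * ENNReal.ofReal (maxConst 1) * eLpNorm (e m) 2 P := by
        intro m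
        have h5 := eLpNorm_lilMaximal_martProj_le hP 1 (-m) (hXm m) le_rfl one_lt_two
        have h6 := eLpNorm_lilMaximal_martProj_le hP 1 0 (hXm m) le_rfl one_lt_two
        simp only [add_zero] at h6
        refine (eLpNorm_mono_enorm (g := (lilMaximal fun (i : ℕ) x => e m (shiftSeq (i + -m) x)) +
          lilMaximal fun (i : ℕ) x => e m (shiftSeq i x)) fun x => ?_).trans
          ((eLpNorm_add_le ?_ ?_ (by simp)).trans ((add_le_add h5 h6).trans (le_of_eq ?_)))
        · exact lilMaximal_sub_le (fun (i : ℕ) x => e m (shiftSeq (i + -m) x))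
            (fun (i : ℕ) x => e m (shiftSeq i x)) x
        · exact (measurable_lilMaximal fun i =>
            (hem m).comp (measurable_shiftSeq _)).aemeasurable.aestronglyMeasurable
        · exact (measurable_lilMaximal fun i =>
            (hem m).comp (measurable_shiftSeq _)).aemeasurable.aestronglyMeasurable
        · ring
      have h5 : ∫⁻ x, ∑' m, lilMaximal (E m) x ∂P ≠ ∞ := by
        rw [lintegral_tsum fun m => (measurable_lilMaximal (hEm m)).aemeasurable]
        refine ne_of_lt (lt_of_le_of_lt (ENNReal.tsum_le_tsum fun m => ?_)
          (?_ : ∑' m, 2 * ENNReal.ofReal (maxConst 1) * eLpNorm (e m) 2 P < ∞))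
        · have := h4 m
          rwa [ENNReal.ofReal_one, eLpNorm_one_eq_lintegral_enorm] at this
        · rw [ENNReal.tsum_mul_left]
          exact ENNReal.mul_lt_top (by finiteness) hefin.lt_top
      filter_upwards [ae_lt_top (Measurable.tsum fun m => measurable_lilMaximal (hEm m)) h5]
        with x hx using hx.ne
    filter_upwards [h1, h2, h3] with x h1 h2 h3
    have h4 := isLittleO_partialSum_of_hasSum (R := fun (n : ℕ) x =>
      Z (shiftSeq n x) - g (shiftSeq n x)) h1 h2 h3
    refine h4.congr_left fun n => ?_
    simp only [partialSum, Finset.sum_sub_distrib]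
    rfl

end Canonical

namespace IsClassLambda

variable {φ : ℝ → ℝ}

theorem nonneg (h : IsClassLambda φ) {x : ℝ} (hx : 0 ≤ x) : 0 ≤ φ x := by
  have := h.monotoneOn (Set.mem_Ici.2 le_rfl) (Set.mem_Ici.2 hx) hx
  rwa [h.map_zero] at this

theorem map_mul_le (h : IsClassLambda φ) {x l : ℝ} (hx : 0 ≤ x) (hl : 1 ≤ l) :
    φ (l * x) ≤ l * φ x := by
  have hl0 : 0 < l := zero_lt_one.trans_le hl
  have hlx : 0 ≤ l * x := mul_nonneg hl0.le hx
  rcases h.shape with hc | ⟨α, h0, h1, hα⟩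
  · have h2 := hc.2 (Set.mem_Ici.2 hlx) (Set.mem_Ici.2 (le_refl (0 : ℝ)))
      (inv_nonneg.2 hl0.le) (sub_nonneg.2 (inv_le_one_of_one_le₀ hl))
      (add_sub_cancel _ _)
    simp only [smul_eq_mul, mul_zero, add_zero, h.map_zero, ne_eq, OfNat.ofNat_ne_zero,
      not_false_eq_true, zero_pow] at h2
    rw [inv_mul_cancel_left₀ hl0.ne', inv_mul_le_iff₀ hl0] at h2
    refine le_of_sq_le_sq ?_ (mul_nonneg hl0.le (h.nonneg hx))
    rw [mul_pow]
    nlinarith [mul_nonneg (sub_nonneg.2 hl) hl0.le, sq_nonneg (φ x)]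
  · rw [hα _ hlx, hα _ hx, mul_min_of_nonneg _ _ hl0.le, mul_one]
    refine min_le_min hl ?_
    rw [Real.mul_rpow hl0.le hx]
    refine mul_le_mul_of_nonneg_right ?_ (Real.rpow_nonneg hx _)
    simpa using Real.rpow_le_rpow_of_exponent_le hl h1

theorem le_one_add_div_mul (h : IsClassLambda φ) {u A : ℝ} (hu : 0 ≤ u) (hA : 0 < A) :
    φ u ≤ (1 + u / A) * φ A := by
  have h0 := h.nonneg hA.le
  have hd : 0 ≤ u / A := by positivity
  rcases le_total u A with huA | huA
  · have := h.monotoneOn (Set.mem_Ici.2 hu) (Set.mem_Ici.2 hA.le) huA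
    nlinarith
  · have := h.map_mul_le hA.le ((one_le_div hA).2 huA)
    rw [div_mul_cancel₀ _ hA.ne'] at this
    nlinarith

end IsClassLambda

section Linear

variable {Ω : Type*} {mΩ : MeasurableSpace Ω} {μ : Measure Ω} {ξ : ℤ → Ω → ℝ}

/-- The σ-algebra generated by the variables with index in `S`. -/
abbrev idxSigma (ξ : ℤ → Ω → ℝ) (S : Set ℤ) : MeasurableSpace Ω :=
  ⨆ j ∈ S, MeasurableSpace.comap (ξ j) inferInstance

theorem idxSigma_mono (ξ : ℤ → Ω → ℝ) {S T : Set ℤ} (h : S ⊆ T) : idxSigma ξ S ≤ idxSigma ξ T :=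
  biSup_mono h

theorem idxSigma_le (hξ : ∀ n, Measurable (ξ n)) (S : Set ℤ) : idxSigma ξ S ≤ mΩ :=
  iSup₂_le fun j _ => (hξ j).comap_le

theorem indep_idxSigma (hξ : ∀ n, Measurable (ξ n)) (hind : iIndepFun ξ μ) {S T : Set ℤ}
    (h : Disjoint S T) : Indep (idxSigma ξ S) (idxSigma ξ T) μ :=
  indep_iSup_of_disjoint (fun n => (hξ n).comap_le) hind h

theorem measurable_linProcess {a : ℤ → ℝ} {n : ℤ} {S : Set ℤ} (h : ∀ k, a k ≠ 0 → n - k ∈ S) :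
    Measurable[idxSigma ξ S] (linProcess a ξ n) := by
  refine measurable_real_tsum (m := idxSigma ξ S) fun k => ?_
  by_cases hk : a k = 0
  · simp only [hk, zero_mul]
    exact measurable_const
  · refine Measurable.const_mul ?_ _
    refine (comap_measurable (ξ (n - k))).mono ?_ le_rfl
    exact le_iSup₂_of_le (n - k) (h k hk) le_rfl

theorem measurable_linProcess' (hξ : ∀ n, Measurable (ξ n)) (a : ℤ → ℝ) (n : ℤ) :
    Measurable (linProcess a ξ n) :=
  measurable_real_tsum fun k => (hξ (n - k)).const_mul (a k)

theorem eLpNorm_const_mul_coord (hξ : ∀ n, IdentDistrib (ξ n) (ξ 0) μ μ) (c : ℝ) (j : ℤ)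
    (p : ℝ≥0∞) :
    eLpNorm (fun ω => c * ξ j ω) p μ = ‖c‖ₑ * eLpNorm (ξ 0) p μ := by
  rw [← (hξ j).eLpNorm_eq]
  exact eLpNorm_const_smul c (ξ j) p μ

theorem tsum_eLpNorm_linear (hξ : ∀ n, IdentDistrib (ξ n) (ξ 0) μ μ) {a : ℤ → ℝ}
    (ha : Summable fun n => |a n|) (n : ℤ) (p : ℝ≥0∞) :
    ∑' k, eLpNorm (fun ω => a k * ξ (n - k) ω) p μ =
      ENNReal.ofReal (∑' k, |a k|) * eLpNorm (ξ 0) p μ := by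
  simp_rw [eLpNorm_const_mul_coord hξ]
  rw [ENNReal.tsum_mul_right, ENNReal.ofReal_tsum_of_nonneg (fun k => abs_nonneg _) ha]
  simp_rw [Real.enorm_eq_ofReal_abs]

theorem ae_summable_linear (hm : ∀ n, Measurable (ξ n)) (hξ : ∀ n, IdentDistrib (ξ n) (ξ 0) μ μ)
    {a : ℤ → ℝ} (ha : Summable fun n => |a n|) {p : ℝ≥0∞} (hp : 1 ≤ p) (h0 : MemLp (ξ 0) p μ)
    (n : ℤ) : ∀ᵐ ω ∂μ, Summable fun k => a k * ξ (n - k) ω := by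
  have h1 := summable_norm_of_tsum_eLpNorm_ne_top hp
    (f := fun k ω => a k * ξ (n - k) ω) (μ := μ)
    (fun k => ((hm (n - k)).const_mul (a k)).aestronglyMeasurable) (by
      rw [tsum_eLpNorm_linear hξ ha]
      exact ENNReal.mul_ne_top ENNReal.ofReal_ne_top h0.eLpNorm_lt_top.ne)
  filter_upwards [h1] with ω hω using hω.of_norm

theorem eLpNorm_linProcess_le (hm : ∀ n, Measurable (ξ n))
    (hξ : ∀ n, IdentDistrib (ξ n) (ξ 0) μ μ) {a : ℤ → ℝ} (ha : Summable fun n => |a n|) {p : ℝ}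
    (hp : 1 ≤ p) (n : ℤ) :
    eLpNorm (linProcess a ξ n) (ENNReal.ofReal p) μ ≤
      ENNReal.ofReal (∑' k, |a k|) * eLpNorm (ξ 0) (ENNReal.ofReal p) μ := by
  rw [← tsum_eLpNorm_linear hξ ha n]
  have h2 := eLpNorm_tsum_le (μ := μ) hp (Z := fun k ω => ‖a k * ξ (n - k) ω‖ₑ) fun k =>
    ((hm (n - k)).const_mul (a k)).enorm.aemeasurable
  simp only [eLpNorm_enorm] at h2
  exact (eLpNorm_mono_enorm fun ω => enorm_tsum_le_tsum_enorm).trans h2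

theorem eLpNorm_two_mul_of_indepFun {X Y : Ω → ℝ} (hX : Measurable X) (hY : Measurable Y)
    (h : IndepFun X Y μ) :
    eLpNorm (fun ω => X ω * Y ω) 2 μ = eLpNorm X 2 μ * eLpNorm Y 2 μ := by
  simp only [eLpNorm_eq_lintegral_rpow_enorm_toReal two_ne_zero ENNReal.ofNat_ne_top,
    ENNReal.toReal_ofNat]
  rw [← ENNReal.mul_rpow_of_nonneg _ _ (by norm_num : (0 : ℝ) ≤ 1 / 2)]
  congr 1
  have hφ : Measurable fun x : ℝ => ‖x‖ₑ ^ (2 : ℝ) := measurable_enorm.pow_const _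
  have := lintegral_mul_eq_lintegral_mul_lintegral_of_indepFun (hφ.comp hX) (hφ.comp hY)
    (h.comp hφ hφ)
  simp only [Pi.mul_apply, Function.comp_apply] at this
  rw [← this]
  simp_rw [enorm_mul, ENNReal.mul_rpow_of_nonneg _ _ zero_le_two]

theorem eLpNorm_abs_rpow_le (X : Ω → ℝ) {r : ℝ} (hr : 1 ≤ r) {c : ℝ} (hc : 0 ≤ c)
    (h : eLpNorm X (ENNReal.ofReal (2 * r)) μ ≤ ENNReal.ofReal c) :
    eLpNorm (fun ω => |X ω| ^ r) 2 μ ≤ ENNReal.ofReal (c ^ r) := by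
  have h1 := eLpNorm_norm_rpow (μ := μ) (p := 2) X (zero_lt_one.trans_le hr)
  rw [← ENNReal.ofReal_ofNat, ← ENNReal.ofReal_mul zero_le_two] at h1
  simp only [Real.norm_eq_abs, ENNReal.ofReal_ofNat] at h1
  rw [h1, ← ENNReal.ofReal_rpow_of_nonneg hc (by linarith)]
  exact ENNReal.rpow_le_rpow h (by linarith)

theorem abs_add_rpow_le {r : ℝ} (hr : 0 ≤ r) (x y : ℝ) :
    |x + y| ^ r ≤ 2 ^ r * (|x| ^ r + |y| ^ r) := by
  have hx := abs_nonneg x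
  have hy := abs_nonneg y
  have h1 : |x + y| ≤ 2 * max |x| |y| :=
    (abs_add_le x y).trans (by linarith [le_max_left |x| |y|, le_max_right |x| |y|])
  have h2 : (max |x| |y|) ^ r ≤ |x| ^ r + |y| ^ r := by
    rcases le_total |x| |y| with h | h
    · rw [max_eq_right h]; exact le_add_of_nonneg_left (Real.rpow_nonneg hx r)
    · rw [max_eq_left h]; exact le_add_of_nonneg_right (Real.rpow_nonneg hy r)
  calc |x + y| ^ r ≤ (2 * max |x| |y|) ^ r := Real.rpow_le_rpow (abs_nonneg _) h1 hr
    _ = 2 ^ r * (max |x| |y|) ^ r := Real.mul_rpow zero_le_two (le_max_of_le_left hx)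
    _ ≤ _ := mul_le_mul_of_nonneg_left h2 (by positivity)

/-- The growth condition on `f` of the theorem. -/
def HasModulus (φ f : ℝ → ℝ) (r : ℝ) : Prop :=
  ∀ x y, |f x - f y| ≤ φ |x - y| * (1 + |x| ^ r + |y| ^ r)

theorem HasModulus.continuous {φ f : ℝ → ℝ} {r : ℝ} (hφ : IsClassLambda φ) (hr : 0 ≤ r)
    (hf : HasModulus φ f r) : Continuous f := by
  refine continuous_iff_continuousAt.2 fun y => ?_
  have h1 : Tendsto (fun x => φ |x - y| * (1 + |x| ^ r + |y| ^ r)) (𝓝 y) (𝓝 0) := by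
    have h2 : Tendsto (fun x => φ |x - y|) (𝓝 y) (𝓝 0) := by
      have h3 : Tendsto φ (𝓝[Set.Ici 0] 0) (𝓝 0) := by
        have := hφ.continuousOn 0 (Set.mem_Ici.2 le_rfl)
        rwa [ContinuousWithinAt, hφ.map_zero] at this
      refine h3.comp (tendsto_nhdsWithin_iff.2 ⟨?_, Eventually.of_forall fun x =>
        Set.mem_Ici.2 (abs_nonneg _)⟩)
      have : Continuous fun x => |x - y| := by fun_prop
      simpa using this.tendsto y
    have h4 : Continuous fun x : ℝ => 1 + |x| ^ r + |y| ^ r := by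
      have : Continuous fun x : ℝ => |x| ^ r := continuous_abs.rpow_const fun _ => Or.inr hr
      fun_prop
    simpa using h2.mul (h4.tendsto y)
  refine tendsto_iff_norm_sub_tendsto_zero.2 (squeeze_zero (fun _ => norm_nonneg _)
    (fun x => hf x y) h1)

theorem memLp_comp_of_hasModulus [IsProbabilityMeasure μ] {φ f : ℝ → ℝ} {r : ℝ}
    (hφ : IsClassLambda φ) (hr : 1 ≤ r) (hf : HasModulus φ f r) {Y : Ω → ℝ} (hYm : Measurable Y)
    (hY : eLpNorm Y (ENNReal.ofReal (2 * r)) μ < ∞) : MemLp (fun ω => f (Y ω)) 2 μ := by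
  obtain ⟨K, hK⟩ := hφ.bounded
  have hfc := hf.continuous hφ (by linarith)
  have h1 : MemLp (fun ω => |Y ω| ^ r) 2 μ := by
    refine ⟨(hYm.abs.pow_const r).aestronglyMeasurable, ?_⟩
    refine (eLpNorm_abs_rpow_le Y hr ENNReal.toReal_nonneg
      (ENNReal.ofReal_toReal hY.ne).ge).trans_lt ENNReal.ofReal_lt_top
  have h1' : MemLp (fun ω => 1 + |Y ω| ^ r) 2 μ := (memLp_const (1 : ℝ)).add h1
  have h2 : MemLp (fun ω => |f 0| + K * (1 + |Y ω| ^ r)) 2 μ :=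
    (memLp_const |f 0|).add (h1'.const_mul K)
  refine h2.mono (hfc.measurable.comp hYm).aestronglyMeasurable (Eventually.of_forall fun ω => ?_)
  have h3 := hf (Y ω) 0
  have h4 : (0 : ℝ) ^ r = 0 := Real.zero_rpow (by linarith)
  simp only [sub_zero, abs_zero, h4, add_zero] at h3
  have h5 : φ |Y ω| ≤ K := (le_abs_self _).trans (hK _ (abs_nonneg _))
  have h6 : 0 ≤ |Y ω| ^ r := Real.rpow_nonneg (abs_nonneg _) r
  rw [Real.norm_eq_abs, Real.norm_eq_abs]
  refine le_trans ?_ (le_abs_self _)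
  have h7 : |f (Y ω)| ≤ |f 0| + |f (Y ω) - f 0| := by
    have := abs_add_le (f 0) (f (Y ω) - f 0)
    rwa [add_sub_cancel] at this
  have h8 := mul_le_mul_of_nonneg_right h5 (by linarith : 0 ≤ 1 + |Y ω| ^ r)
  linarith

end Linear

section Estimate

variable {Ω : Type*} {mΩ : MeasurableSpace Ω} {μ : Measure Ω} [IsProbabilityMeasure μ]
  {ξ : ℤ → Ω → ℝ}

/-- Pointwise bound for the effect of a perturbation `u` of the argument `z`. -/
theorem abs_sub_le_of_hasModulus {φ f : ℝ → ℝ} {r K A : ℝ} (hφ : IsClassLambda φ)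
    (hf : HasModulus φ f r) (hr : 0 ≤ r) (hK : ∀ x, 0 ≤ x → |φ x| ≤ K) (hA : 0 < A) (z u : ℝ) :
    |f (z + u) - f z| ≤ (2 ^ r + 1) * φ A * ((1 + |u| / A) * (1 + |z| ^ r)) +
      (2 ^ r + 1) * K * |u| ^ r := by
  have h1 := hf (z + u) z
  rw [add_sub_cancel_left] at h1
  have h2 := abs_add_rpow_le hr z u
  have h3 := hφ.le_one_add_div_mul (abs_nonneg u) hA
  have h4 := hφ.nonneg (abs_nonneg u)
  have h5 : φ |u| ≤ K := (le_abs_self _).trans (hK _ (abs_nonneg u))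
  have hz : 0 ≤ |z| ^ r := Real.rpow_nonneg (abs_nonneg z) r
  have hu : 0 ≤ |u| ^ r := Real.rpow_nonneg (abs_nonneg u) r
  have h2r : (0 : ℝ) < 2 ^ r := by positivity
  calc |f (z + u) - f z| ≤ φ |u| * (1 + |z + u| ^ r + |z| ^ r) := h1
    _ ≤ φ |u| * ((2 ^ r + 1) * ((1 + |z| ^ r) + |u| ^ r)) := by
        refine mul_le_mul_of_nonneg_left ?_ h4
        nlinarith
    _ = (2 ^ r + 1) * (φ |u| * (1 + |z| ^ r)) + (2 ^ r + 1) * (φ |u| * |u| ^ r) := by ring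
    _ ≤ (2 ^ r + 1) * ((1 + |u| / A) * φ A * (1 + |z| ^ r)) + (2 ^ r + 1) * (K * |u| ^ r) := by
        gcongr
    _ = _ := by ring

theorem summable_abs_indicator {a : ℤ → ℝ} (ha : Summable fun n => |a n|) (S : Set ℤ) :
    Summable fun n => |S.indicator a n| :=
  (ha.of_abs.indicator S).abs

theorem tsum_abs_indicator_le {a : ℤ → ℝ} (ha : Summable fun n => |a n|) (S : Set ℤ) :
    ∑' n, |S.indicator a n| ≤ ∑' n, |a n| := by
  refine (summable_abs_indicator ha S).tsum_le_tsum (fun n => ?_) ha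
  by_cases hn : n ∈ S
  · rw [Set.indicator_of_mem hn]
  · rw [Set.indicator_of_notMem hn, abs_zero]; exact abs_nonneg _

theorem exists_eLpNorm_sub_le (hm : ∀ n, Measurable (ξ n)) (hind : iIndepFun ξ μ)
    (hξ : ∀ n, IdentDistrib (ξ n) (ξ 0) μ μ) {a : ℤ → ℝ} (ha : Summable fun n => |a n|)
    {φ f : ℝ → ℝ} {r : ℝ} (hr : 1 ≤ r) (h0 : MemLp (ξ 0) (ENNReal.ofReal (2 * r)) μ)
    (hφ : IsClassLambda φ) (hf : HasModulus φ f r) :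
    ∃ C : ℝ, 0 ≤ C ∧ ∀ S : Set ℤ,
      eLpNorm (fun ω => f (linProcess a ξ 0 ω) - f (linProcess (Sᶜ.indicator a) ξ 0 ω)) 2 μ ≤
        ENNReal.ofReal (C * φ (∑' k, |S.indicator a k|)) := by
  obtain ⟨K, hK⟩ := hφ.bounded
  have hK0 : 0 ≤ K := (abs_nonneg _).trans (hK 0 le_rfl)
  have hr0 : 0 ≤ r := by linarith
  set B := ∑' k, |a k| with hB
  have hB0 : 0 ≤ B := tsum_nonneg fun _ => abs_nonneg _
  set N := (eLpNorm (ξ 0) (ENNReal.ofReal (2 * r)) μ).toReal with hN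
  have hNe : eLpNorm (ξ 0) (ENNReal.ofReal (2 * r)) μ = ENNReal.ofReal N :=
    (ENNReal.ofReal_toReal h0.eLpNorm_lt_top.ne).symm
  have hN0 : 0 ≤ N := ENNReal.toReal_nonneg
  have h2r : (0 : ℝ) ≤ 2 ^ r := by positivity
  set C := (2 ^ r + 1) * ((1 + N) * (1 + (B * N) ^ r)) +
    (2 ^ r + 1) * K * (B ^ (r - 1) * N ^ r * (B / φ B)) with hC
  have hφB : 0 ≤ φ B := hφ.nonneg hB0
  have hC0 : 0 ≤ C := by
    have := Real.rpow_nonneg (mul_nonneg hB0 hN0) r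
    have := Real.rpow_nonneg hB0 (r - 1)
    have := Real.rpow_nonneg hN0 r
    positivity
  refine ⟨C, hC0, fun S => ?_⟩
  set A := ∑' k, |S.indicator a k| with hAdef
  have hsumS := summable_abs_indicator ha S
  have hA0 : 0 ≤ A := tsum_nonneg fun _ => abs_nonneg _
  have hAB : A ≤ B := tsum_abs_indicator_le ha S
  rcases hA0.eq_or_lt with hA | hA
  · have hz : ∀ k, S.indicator a k = 0 := fun k => by
      have h1 := hsumS.hasSum
      rw [← hAdef, ← hA] at h1
      exact abs_eq_zero.1 (congrFun
        ((hasSum_zero_iff_of_nonneg (fun k => abs_nonneg (S.indicator a k))).1 h1) k)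
    have hSa : Sᶜ.indicator a = a := by
      have := Set.indicator_self_add_compl S a
      rwa [show S.indicator a = 0 from funext hz, zero_add] at this
    simp [hSa]
  have hBpos : 0 < B := hA.trans_le hAB
  set U := linProcess (S.indicator a) ξ 0 with hU
  set Z := linProcess (Sᶜ.indicator a) ξ 0 with hZ
  have hsum : ∀ᵐ ω ∂μ, linProcess a ξ 0 ω = Z ω + U ω := by
    have hp : (1 : ℝ≥0∞) ≤ ENNReal.ofReal (2 * r) := ENNReal.one_le_ofReal.2 (by linarith)
    filter_upwards [ae_summable_linear hm hξ hsumS hp h0 0,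
      ae_summable_linear hm hξ (summable_abs_indicator ha Sᶜ) hp h0 0] with ω h1 h2
    simp only [hU, hZ, linProcess]
    rw [← h2.tsum_add h1]
    refine tsum_congr fun k => ?_
    rw [← add_mul, ← Pi.add_apply, Set.indicator_compl_add_self]
  rcases hφB.eq_or_lt with hφ0 | hφpos
  · have : ∀ x y, f x = f y := fun x y => by
      have h1 := hφ.le_one_add_div_mul (abs_nonneg (x - y)) hBpos
      rw [← hφ0, mul_zero] at h1
      have h2 := hf x y
      rw [le_antisymm h1 (hφ.nonneg (abs_nonneg _)), zero_mul] at h2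
      exact sub_eq_zero.1 (abs_eq_zero.1 (le_antisymm h2 (abs_nonneg _)))
    have h3 : (fun ω => f (linProcess a ξ 0 ω) - f (Z ω)) = 0 := funext fun ω => by
      rw [this _ (Z ω), sub_self]; rfl
    rw [h3, eLpNorm_zero]
    exact zero_le
  have hUm : Measurable U := measurable_linProcess' hm _ 0
  have hZm : Measurable Z := measurable_linProcess' hm _ 0
  have hUn : eLpNorm U (ENNReal.ofReal (2 * r)) μ ≤ ENNReal.ofReal (A * N) := by
    rw [ENNReal.ofReal_mul hA0, ← hNe]
    exact eLpNorm_linProcess_le hm hξ hsumS (by linarith) 0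
  have hZn : eLpNorm Z (ENNReal.ofReal (2 * r)) μ ≤ ENNReal.ofReal (B * N) := by
    refine (eLpNorm_linProcess_le hm hξ (summable_abs_indicator ha Sᶜ) (by linarith) 0).trans ?_
    rw [ENNReal.ofReal_mul hB0, ← hNe]
    exact mul_le_mul' (ENNReal.ofReal_le_ofReal (tsum_abs_indicator_le ha _)) le_rfl
  have hU2 : eLpNorm U 2 μ ≤ ENNReal.ofReal (A * N) := by
    refine (eLpNorm_le_eLpNorm_of_exponent_le ?_ hUm.aestronglyMeasurable).trans hUn
    rw [← ENNReal.ofReal_ofNat]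
    exact ENNReal.ofReal_le_ofReal (by linarith)
  have hindep : IndepFun U Z μ := by
    have h1 := indep_idxSigma hm hind (S := (fun k => -k) ⁻¹' S) (T := (fun k => -k) ⁻¹' Sᶜ)
      (disjoint_compl_right.preimage _)
    refine indep_of_indep_of_le_left (indep_of_indep_of_le_right h1 ?_) ?_
    · refine (measurable_linProcess fun k hk => ?_).comap_le
      simpa using Set.mem_of_indicator_ne_zero hk
    · refine (measurable_linProcess fun k hk => ?_).comap_le
      simpa using Set.mem_of_indicator_ne_zero hk
  have hG1m : Measurable fun x : ℝ => 1 + |x| / A := by fun_prop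
  have hG2m : Measurable fun x : ℝ => 1 + |x| ^ r := by fun_prop
  have hone : eLpNorm (fun _ : Ω => (1 : ℝ)) 2 μ = 1 := by
    rw [eLpNorm_const _ two_ne_zero (NeZero.ne μ)]; simp
  have hG1 : eLpNorm (fun ω => 1 + |U ω| / A) 2 μ ≤ ENNReal.ofReal (1 + N) := by
    refine (eLpNorm_add_le (f := fun _ => (1 : ℝ)) (g := fun ω => |U ω| / A)
      aestronglyMeasurable_const (by fun_prop) (by norm_num)).trans ?_
    rw [hone, ENNReal.ofReal_add zero_le_one hN0, ENNReal.ofReal_one]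
    refine add_le_add le_rfl ?_
    have h1 : eLpNorm (fun ω => |U ω| / A) 2 μ = ‖A⁻¹‖ₑ * eLpNorm U 2 μ := by
      rw [← eLpNorm_norm U, ← eLpNorm_const_smul]
      congr 1
      ext ω
      simp [div_eq_inv_mul]
    rw [h1, Real.enorm_of_nonneg (inv_nonneg.2 hA0)]
    refine (mul_le_mul' le_rfl hU2).trans ?_
    rw [← ENNReal.ofReal_mul (inv_nonneg.2 hA0), inv_mul_cancel_left₀ hA.ne']
  have hG2 : eLpNorm (fun ω => 1 + |Z ω| ^ r) 2 μ ≤ ENNReal.ofReal (1 + (B * N) ^ r) := by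
    refine (eLpNorm_add_le (f := fun _ => (1 : ℝ)) (g := fun ω => |Z ω| ^ r)
      aestronglyMeasurable_const (by fun_prop) (by norm_num)).trans ?_
    rw [hone, ENNReal.ofReal_add zero_le_one (Real.rpow_nonneg (mul_nonneg hB0 hN0) r),
      ENNReal.ofReal_one]
    exact add_le_add le_rfl (eLpNorm_abs_rpow_le Z hr (mul_nonneg hB0 hN0) hZn)
  have hG12 : eLpNorm (fun ω => (1 + |U ω| / A) * (1 + |Z ω| ^ r)) 2 μ ≤
      ENNReal.ofReal ((1 + N) * (1 + (B * N) ^ r)) := by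
    have h1 := eLpNorm_two_mul_of_indepFun (hG1m.comp hUm) (hG2m.comp hZm) (hindep.comp hG1m hG2m)
    simp only [Function.comp_apply] at h1
    rw [h1, ENNReal.ofReal_mul (by positivity)]
    exact mul_le_mul' hG1 hG2
  have hUr : eLpNorm (fun ω => |U ω| ^ r) 2 μ ≤
      ENNReal.ofReal (B ^ (r - 1) * N ^ r * (B / φ B) * φ A) := by
    refine (eLpNorm_abs_rpow_le U hr (mul_nonneg hA0 hN0) hUn).trans (ENNReal.ofReal_le_ofReal ?_)
    have h1 : A ≤ B / φ B * φ A := by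
      have := hφ.map_mul_le hA.le ((one_le_div hA).2 hAB)
      rw [div_mul_cancel₀ _ hA.ne', div_mul_eq_mul_div, le_div_iff₀ hA] at this
      rw [div_mul_eq_mul_div, le_div_iff₀ hφpos]
      linarith
    have h2 : A ^ (r - 1) ≤ B ^ (r - 1) := Real.rpow_le_rpow hA0 hAB (by linarith)
    have h3 : A ^ r = A ^ (r - 1) * A := by
      rw [← Real.rpow_add_one hA.ne', sub_add_cancel]
    have h4 := Real.rpow_nonneg hN0 r
    have h5 := Real.rpow_nonneg hB0 (r - 1)
    calc (A * N) ^ r = A ^ (r - 1) * A * N ^ r := by rw [Real.mul_rpow hA0 hN0, h3]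
      _ ≤ B ^ (r - 1) * (B / φ B * φ A) * N ^ r := by gcongr
      _ = _ := by ring
  have hφA := hφ.nonneg hA0
  set c1 := (2 ^ r + 1) * φ A with hc1
  set c2 := (2 ^ r + 1) * K with hc2
  have hc10 : 0 ≤ c1 := by positivity
  have hc20 : 0 ≤ c2 := by positivity
  calc eLpNorm (fun ω => f (linProcess a ξ 0 ω) - f (Z ω)) 2 μ
      ≤ eLpNorm ((c1 • fun ω => (1 + |U ω| / A) * (1 + |Z ω| ^ r)) +
          c2 • fun ω => |U ω| ^ r) 2 μ := by
        refine eLpNorm_mono_ae_real ?_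
        filter_upwards [hsum] with ω hω
        rw [hω]
        exact abs_sub_le_of_hasModulus hφ hf hr0 hK hA (Z ω) (U ω)
    _ ≤ eLpNorm (c1 • fun ω => (1 + |U ω| / A) * (1 + |Z ω| ^ r)) 2 μ +
          eLpNorm (c2 • fun ω => |U ω| ^ r) 2 μ := by
        refine eLpNorm_add_le ?_ ?_ (by norm_num)
        · exact (((hG1m.comp hUm).mul (hG2m.comp hZm)).const_smul c1).aestronglyMeasurable
        · exact ((hUm.abs.pow_const r).const_smul c2).aestronglyMeasurable
    _ ≤ ENNReal.ofReal c1 * ENNReal.ofReal ((1 + N) * (1 + (B * N) ^ r)) +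
          ENNReal.ofReal c2 * ENNReal.ofReal (B ^ (r - 1) * N ^ r * (B / φ B) * φ A) := by
        rw [eLpNorm_const_smul, eLpNorm_const_smul, Real.enorm_of_nonneg hc10,
          Real.enorm_of_nonneg hc20]
        exact add_le_add (mul_le_mul' le_rfl hG12) (mul_le_mul' le_rfl hUr)
    _ = ENNReal.ofReal (C * φ A) := by
        have := Real.rpow_nonneg (mul_nonneg hB0 hN0) r
        have := Real.rpow_nonneg hB0 (r - 1)
        have := Real.rpow_nonneg hN0 r
        rw [← ENNReal.ofReal_mul hc10, ← ENNReal.ofReal_mul hc20, ← ENNReal.ofReal_add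
          (by positivity) (by positivity)]
        congr 1
        rw [hC, hc1, hc2]
        ring

end Estimate

section Projections

variable {Ω : Type*} {mΩ : MeasurableSpace Ω} {μ : Measure Ω} {ξ : ℤ → Ω → ℝ}

theorem martProj_add {n : ℤ} {Z W : Ω → ℝ} (hZ : Integrable Z μ) (hW : Integrable W μ) :
    martProj μ ξ n (Z + W) =ᵐ[μ] martProj μ ξ n Z + martProj μ ξ n W := by
  filter_upwards [condExp_add hZ hW (pastSigma ξ n), condExp_add hZ hW (pastSigma ξ (n - 1))]
    with ω h1 h2
  simp only [martProj, Pi.sub_apply, Pi.add_apply] at *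
  rw [h1, h2]
  ring

variable [IsProbabilityMeasure μ]

theorem setIntegral_eq_mul_of_indep {m₁ m₂ : MeasurableSpace Ω} (h1 : m₁ ≤ mΩ) (h2 : m₂ ≤ mΩ)
    (hind : Indep m₁ m₂ μ) {W : Ω → ℝ} (hW : StronglyMeasurable[m₁] W) (hWi : Integrable W μ)
    {s : Set Ω} (hs : MeasurableSet[m₂] s) :
    ∫ ω in s, W ω ∂μ = μ.real s * ∫ ω, W ω ∂μ := by
  have h3 := condExp_indep_eq h1 h2 hW hind
  rw [← setIntegral_condExp h2 hWi hs, setIntegral_congr_ae (h2 s hs)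
    (h3.mono fun ω h _ => h), setIntegral_const, smul_eq_mul]

theorem pastSigma_eq_sup (ξ : ℤ → Ω → ℝ) (i : ℤ) :
    pastSigma ξ i = pastSigma ξ (i - 1) ⊔ MeasurableSpace.comap (ξ i) inferInstance := by
  refine le_antisymm (iSup₂_le fun j hj => ?_) (sup_le (pastSigma_mono ξ (by lia))
    (le_iSup₂_of_le i le_rfl le_rfl))
  rcases hj.eq_or_lt with rfl | hj
  · exact le_sup_right
  · exact le_sup_of_le_left (le_iSup₂_of_le j (by lia) le_rfl)

theorem sup_eq_generateFrom_inter (m₁ m₂ : MeasurableSpace Ω) :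
    m₁ ⊔ m₂ = MeasurableSpace.generateFrom
      {t | ∃ s₁ s₂, MeasurableSet[m₁] s₁ ∧ MeasurableSet[m₂] s₂ ∧ s₁ ∩ s₂ = t} := by
  refine le_antisymm (sup_le (fun s hs => ?_) fun s hs => ?_) (MeasurableSpace.generateFrom_le ?_)
  · exact MeasurableSpace.measurableSet_generateFrom
      ⟨s, Set.univ, hs, MeasurableSet.univ, Set.inter_univ s⟩
  · exact MeasurableSpace.measurableSet_generateFrom
      ⟨Set.univ, s, MeasurableSet.univ, hs, Set.univ_inter s⟩
  · rintro _ ⟨s₁, s₂, h1, h2, rfl⟩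
    exact MeasurableSet.inter ((le_sup_left : m₁ ≤ m₁ ⊔ m₂) _ h1)
      ((le_sup_right : m₂ ≤ m₁ ⊔ m₂) _ h2)

theorem isPiSystem_inter (m₁ m₂ : MeasurableSpace Ω) :
    IsPiSystem {t | ∃ s₁ s₂, MeasurableSet[m₁] s₁ ∧ MeasurableSet[m₂] s₂ ∧ s₁ ∩ s₂ = t} := by
  rintro _ ⟨s₁, s₂, h1, h2, rfl⟩ _ ⟨t₁, t₂, h3, h4, rfl⟩ -
  exact ⟨s₁ ∩ t₁, s₂ ∩ t₂, h1.inter h3, h2.inter h4, Set.inter_inter_inter_comm _ _ _ _⟩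

/-- A variable that does not depend on `ξ i` has vanishing projection `P_i`. -/
theorem martProj_eq_zero (hm : ∀ n, Measurable (ξ n)) (hind : iIndepFun ξ μ) {S : Set ℤ} {i : ℤ}
    (hi : i ∉ S) {h : Ω → ℝ} (hh : Measurable[idxSigma ξ S] h) (hhi : Integrable h μ) :
    martProj μ ξ i h =ᵐ[μ] 0 := by
  have hF := pastSigma_le hm
  set g := μ[h | pastSigma ξ (i - 1)] with hg
  suffices H : g =ᵐ[μ] μ[h | pastSigma ξ i] by
    filter_upwards [H] with ω hω
    simp only [martProj, Pi.sub_apply, Pi.zero_apply]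
    rw [← hω, sub_self]
  have hgi : Integrable g μ := integrable_condExp
  have hgm : StronglyMeasurable[pastSigma ξ (i - 1)] g := stronglyMeasurable_condExp
  set W := h - g with hW
  have hWi : Integrable W μ := hhi.sub hgi
  set T := S ∪ Set.Iic (i - 1) with hT
  have hWm : StronglyMeasurable[idxSigma ξ T] W :=
    (hh.stronglyMeasurable.mono (idxSigma_mono ξ Set.subset_union_left)).sub
      (hgm.mono (idxSigma_mono ξ (S := Set.Iic (i - 1)) Set.subset_union_right))
  have hTi : Disjoint T {i} := by
    rw [Set.disjoint_singleton_right]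
    rintro (h1 | h1)
    · exact hi h1
    · have : i ≤ i - 1 := h1
      lia
  have hindep : Indep (idxSigma ξ T) (MeasurableSpace.comap (ξ i) inferInstance) μ := by
    have := indep_idxSigma hm hind hTi
    simpa only [idxSigma, Set.mem_singleton_iff, iSup_iSup_eq_left] using this
  have hpast : ∀ s, MeasurableSet[pastSigma ξ (i - 1)] s → ∫ ω in s, W ω ∂μ = 0 := by
    intro s hs
    simp only [hW, Pi.sub_apply]
    rw [integral_sub hhi.integrableOn hgi.integrableOn, setIntegral_condExp (hF _) hhi hs, sub_self]
  have hW0 : ∫ ω, W ω ∂μ = 0 := by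
    rw [← setIntegral_univ]; exact hpast _ MeasurableSet.univ
  have key : ∀ s, MeasurableSet[pastSigma ξ i] s → ∫ ω in s, W ω ∂μ = 0 := by
    intro s hs
    induction s, hs using MeasurableSpace.induction_on_inter
      ((pastSigma_eq_sup ξ i).trans (sup_eq_generateFrom_inter _ _)) (isPiSystem_inter _ _) with
    | empty => simp
    | basic t ht =>
      obtain ⟨s₁, s₂, h1, h2, rfl⟩ := ht
      have h1' : MeasurableSet[idxSigma ξ T] s₁ :=
        idxSigma_mono ξ (S := Set.Iic (i - 1)) Set.subset_union_right _ h1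
      have h3 := setIntegral_eq_mul_of_indep (idxSigma_le hm T) (hm i).comap_le hindep
        (hWm.indicator h1') (hWi.indicator (hF _ _ h1)) h2
      rw [setIntegral_indicator (hF _ _ h1), integral_indicator (hF _ _ h1), hpast _ h1,
        mul_zero] at h3
      rwa [Set.inter_comm]
    | compl t ht ih =>
      have := integral_add_compl (hF i _ ht) hWi
      rw [ih, hW0, zero_add] at this
      exact this
    | iUnion t hd ht ih =>
      rw [integral_iUnion (fun n => hF i _ (ht n)) hd hWi.integrableOn]
      simp [ih]
  refine ae_eq_condExp_of_forall_setIntegral_eq (hF i) hhi (fun s _ _ => hgi.integrableOn)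
    (fun s hs _ => ?_) (hgm.mono (pastSigma_mono ξ (by lia))).aestronglyMeasurable
  have := key s hs
  simp only [hW, Pi.sub_apply] at this
  rw [integral_sub hhi.integrableOn hgi.integrableOn, sub_eq_zero] at this
  exact this.symm

theorem integral_condExp_sq_eq (hm : ∀ n, Measurable (ξ n)) {W : Ω → ℝ} (hW : MemLp W 2 μ) (i : ℤ) :
    ∫ ω, (μ[W | pastSigma ξ i]) ω ^ 2 ∂μ =
      ∫ ω, martProj μ ξ i W ω ^ 2 ∂μ + ∫ ω, (μ[W | pastSigma ξ (i - 1)]) ω ^ 2 ∂μ := by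
  set E := μ[W | pastSigma ξ (i - 1)] with hE
  set p := martProj μ ξ i W with hp
  have hE2 : MemLp E 2 μ := hW.condExp (by norm_num)
  have hp2 : MemLp p 2 μ := memLp_martProj i hW
  have hEp : Integrable (E * p) μ := hE2.integrable_mul hp2
  have h0 : ∫ ω, (E * p) ω ∂μ = 0 := by
    rw [← integral_condExp (pastSigma_le hm (i - 1))]
    have h1 := condExp_mul_of_stronglyMeasurable_left (μ := μ) (m := pastSigma ξ (i - 1))
      (stronglyMeasurable_condExp (f := W)) hEp (hp2.integrable (by norm_num))
    rw [integral_congr_ae (g := fun _ => (0 : ℝ)), integral_zero]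
    filter_upwards [h1, condExp_martProj (μ := μ) hm i W] with ω h1 h2
    rw [h1, Pi.mul_apply, h2, Pi.zero_apply, mul_zero]
  have h2 : ∀ ω, (μ[W | pastSigma ξ i]) ω ^ 2 = (p ω ^ 2 + E ω ^ 2) + 2 * (E * p) ω := by
    intro ω
    have : p ω = (μ[W | pastSigma ξ i]) ω - E ω := rfl
    rw [Pi.mul_apply, this]
    ring
  have h3 : Integrable (fun ω => p ω ^ 2 + E ω ^ 2) μ := hp2.integrable_sq.add hE2.integrable_sq
  simp_rw [h2]
  rw [integral_add h3 (hEp.const_mul 2), integral_const_mul, h0, mul_zero, add_zero,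
    integral_add hp2.integrable_sq hE2.integrable_sq]

/-- Bessel's inequality for the projections `P_i`. -/
theorem sum_eLpNorm_martProj_sq_le (hm : ∀ n, Measurable (ξ n)) {W : Ω → ℝ} (hW : MemLp W 2 μ)
    (s : Finset ℤ) :
    ∑ i ∈ s, (eLpNorm (martProj μ ξ i W) 2 μ).toReal ^ 2 ≤ (eLpNorm W 2 μ).toReal ^ 2 := by
  obtain ⟨N, hN⟩ := (Finset.tendsto_Ioc_neg (R := ℤ)).eventually_ge_atTop s |>.exists
  refine (Finset.sum_le_sum_of_subset_of_nonneg hN fun _ _ _ => sq_nonneg _).trans ?_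
  have key : ∀ n : ℕ, ∑ i ∈ Finset.Ioc (-N : ℤ) (-N + n), ∫ ω, martProj μ ξ i W ω ^ 2 ∂μ ≤
      ∫ ω, (μ[W | pastSigma ξ (-N + n)]) ω ^ 2 ∂μ := by
    intro n
    induction n with
    | zero =>
      simp only [Nat.cast_zero, add_zero, Finset.Ioc_self, Finset.sum_empty]
      exact integral_nonneg fun _ => sq_nonneg _
    | succ n ih =>
      have h1 : Finset.Ioc (-N : ℤ) (-N + (n + 1 : ℕ)) =
          insert (-N + (n + 1 : ℕ) : ℤ) (Finset.Ioc (-N : ℤ) (-N + n)) := by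
        ext j; simp only [Finset.mem_Ioc, Finset.mem_insert]; push_cast; lia
      have h2 := integral_condExp_sq_eq hm hW (-N + (n + 1 : ℕ))
      rw [show (-N + (n + 1 : ℕ) - 1 : ℤ) = -N + n by push_cast; ring] at h2
      rw [h1, Finset.sum_insert (by simp), h2]
      exact add_le_add le_rfl ih
  have h3 := key (2 * N)
  rw [show (-N + (2 * N : ℕ) : ℤ) = N by push_cast; ring] at h3
  simp_rw [integral_sq_eq_eLpNorm_sq (memLp_martProj (ξ := ξ) _ hW)] at h3
  refine h3.trans ?_
  rw [integral_sq_eq_eLpNorm_sq (hW.condExp (by norm_num))]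
  exact pow_le_pow_left₀ ENNReal.toReal_nonneg (ENNReal.toReal_mono hW.eLpNorm_lt_top.ne
    (eLpNorm_condExp_le_eLpNorm _ (by norm_num))) 2

end Projections

/-- The sum of `|a k|` over `|k| ≥ n`. -/
def absTail (a : ℤ → ℝ) (n : ℕ) : ℝ := ∑' k, |{k : ℤ | (n : ℤ) ≤ |k|}.indicator a k|

section Tail

variable {a : ℤ → ℝ}

theorem absTail_nonneg (a : ℤ → ℝ) (n : ℕ) : 0 ≤ absTail a n := tsum_nonneg fun _ => abs_nonneg _

theorem absTail_eq_tsum_subtype (a : ℤ → ℝ) (n : ℕ) :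
    absTail a n = ∑' k : {k : ℤ // (n : ℤ) ≤ |k|}, |a k| := by
  have := tsum_subtype {k : ℤ | (n : ℤ) ≤ |k|} fun k => |a k|
  refine Eq.trans (tsum_congr fun k => ?_) this.symm
  by_cases hk : k ∈ {k : ℤ | (n : ℤ) ≤ |k|}
  · rw [Set.indicator_of_mem hk, Set.indicator_of_mem hk]
  · rw [Set.indicator_of_notMem hk, Set.indicator_of_notMem hk, abs_zero]

theorem absTail_antitone (ha : Summable fun n => |a n|) : Antitone (absTail a) := by
  intro m n hmn
  refine (summable_abs_indicator ha _).tsum_le_tsum (fun k => ?_) (summable_abs_indicator ha _)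
  by_cases hk : k ∈ {k : ℤ | (n : ℤ) ≤ |k|}
  · have hk' : k ∈ {k : ℤ | (m : ℤ) ≤ |k|} :=
      le_trans (by exact_mod_cast hmn) (show (n : ℤ) ≤ |k| from hk)
    rw [Set.indicator_of_mem hk, Set.indicator_of_mem hk']
  · rw [Set.indicator_of_notMem hk, abs_zero]; exact abs_nonneg _

theorem tendsto_absTail (ha : Summable fun n => |a n|) : Tendsto (absTail a) atTop (𝓝 0) := by
  have := tendsto_tsum_of_dominated_convergence (𝓕 := atTop) (bound := fun k => |a k|)
    (f := fun (n : ℕ) k => |{k : ℤ | (n : ℤ) ≤ |k|}.indicator a k|) (g := fun _ => (0 : ℝ)) ha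
    (fun k => ?_) (Eventually.of_forall fun n k => ?_)
  · rw [tsum_zero] at this
    exact this
  · refine tendsto_const_nhds.congr' ?_
    filter_upwards [eventually_gt_atTop k.natAbs] with n hn
    have hk : k ∉ {k : ℤ | (n : ℤ) ≤ |k|} := by
      rw [Set.mem_ofPred_eq, not_le, Int.abs_eq_natAbs]
      exact_mod_cast hn
    rw [Set.indicator_of_notMem hk, abs_zero]
  · rw [Real.norm_eq_abs, abs_abs]
    by_cases hk : k ∈ {k : ℤ | (n : ℤ) ≤ |k|}
    · rw [Set.indicator_of_mem hk]
    · rw [Set.indicator_of_notMem hk, abs_zero]; exact abs_nonneg _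

theorem tendsto_comp_absTail {φ : ℝ → ℝ} (hφ : IsClassLambda φ) (ha : Summable fun n => |a n|) :
    Tendsto (fun n => φ (absTail a n)) atTop (𝓝 0) := by
  have h3 : Tendsto φ (𝓝[Set.Ici 0] 0) (𝓝 0) := by
    have := hφ.continuousOn 0 (Set.mem_Ici.2 le_rfl)
    rwa [ContinuousWithinAt, hφ.map_zero] at this
  exact h3.comp (tendsto_nhdsWithin_iff.2 ⟨tendsto_absTail ha,
    Eventually.of_forall fun n => Set.mem_Ici.2 (absTail_nonneg a n)⟩)

theorem summable_sqrt_two_pow_mul {b : ℕ → ℝ} (h0 : ∀ n, 0 ≤ b n) (hb : Antitone b)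
    (hs : Summable fun n : ℕ => b (n + 1) / √((n : ℝ) + 1)) :
    Summable fun j : ℕ => √(2 ^ j) * b (2 ^ j) := by
  have h1 : Summable fun n : ℕ => b n / √(n : ℝ) := by
    rw [← summable_nat_add_iff 1]
    exact hs.congr fun n => by push_cast; rfl
  have h2 := (summable_condensed_iff_of_nonneg (f := fun n : ℕ => b n / √(n : ℝ))
    (fun n => div_nonneg (h0 n) (Real.sqrt_nonneg _)) fun m n hm hmn => ?_).2 h1
  · refine h2.congr fun j => ?_
    push_cast
    have h3 : √((2 : ℝ) ^ j) ≠ 0 := (Real.sqrt_pos.2 (by positivity)).ne'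
    field_simp
    rw [Real.sq_sqrt (by positivity), mul_comm]
  · have hm' : (0 : ℝ) < m := by exact_mod_cast hm
    exact div_le_div₀ (h0 m) (hb hmn) (Real.sqrt_pos.2 hm')
      (Real.sqrt_le_sqrt (by exact_mod_cast hmn))

/-- Summability over `ℤ` from bounds on dyadic blocks. -/
theorem summable_of_dyadic {c : ℤ → ℝ} {b : ℕ → ℝ} (hc : ∀ i, 0 ≤ c i) (hb : ∀ j, 0 ≤ b j)
    (hbs : Summable b)
    (h : ∀ j : ℕ, ∑ i ∈ Finset.Ioo (-2 ^ (j + 1) : ℤ) (2 ^ (j + 1)) \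
      Finset.Ioo (-2 ^ j : ℤ) (2 ^ j), c i ≤ b j) : Summable c := by
  have key : ∀ n : ℕ, ∑ i ∈ Finset.Ioo (-2 ^ n : ℤ) (2 ^ n), c i ≤
      c 0 + ∑ j ∈ Finset.range n, b j := by
    intro n
    induction n with
    | zero =>
      have : Finset.Ioo (-2 ^ 0 : ℤ) (2 ^ 0) = {0} := by
        ext i; simp only [Finset.mem_Ioo, Finset.mem_singleton]; lia
      rw [this]; simp
    | succ n ih =>
      have hsub : Finset.Ioo (-2 ^ n : ℤ) (2 ^ n) ⊆
          Finset.Ioo (-2 ^ (n + 1) : ℤ) (2 ^ (n + 1)) := by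
        have : (0 : ℤ) < 2 ^ n := by positivity
        refine Finset.Ioo_subset_Ioo ?_ ?_ <;> rw [pow_succ] <;> lia
      rw [← Finset.sum_sdiff hsub, Finset.sum_range_succ]
      linarith [h n]
  refine summable_of_sum_le hc (c := c 0 + ∑' j, b j) fun u => ?_
  obtain ⟨n, hn⟩ : ∃ n : ℕ, u ⊆ Finset.Ioo (-2 ^ n : ℤ) (2 ^ n) := by
    refine ⟨∑ i ∈ u, i.natAbs, fun i hi => ?_⟩
    have h1 : i.natAbs ≤ ∑ i ∈ u, i.natAbs :=
      Finset.single_le_sum (f := fun i : ℤ => i.natAbs) (fun _ _ => Nat.zero_le _) hi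
    have h2 : i.natAbs < 2 ^ (∑ i ∈ u, i.natAbs) := h1.trans_lt Nat.lt_two_pow_self
    have h3 : (i.natAbs : ℤ) < 2 ^ (∑ i ∈ u, i.natAbs) := by exact_mod_cast h2
    rw [Finset.mem_Ioo]
    lia
  calc ∑ i ∈ u, c i ≤ ∑ i ∈ Finset.Ioo (-2 ^ n : ℤ) (2 ^ n), c i :=
        Finset.sum_le_sum_of_subset_of_nonneg hn fun i _ _ => hc i
    _ ≤ c 0 + ∑ j ∈ Finset.range n, b j := key n
    _ ≤ _ := by linarith [hbs.sum_le_tsum (Finset.range n) fun j _ => hb j]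

end Tail

section Setting

variable {Ω : Type*} {mΩ : MeasurableSpace Ω} {μ : Measure Ω}
  {ξ : ℤ → Ω → ℝ} {a : ℤ → ℝ} {φ f : ℝ → ℝ} {r : ℝ}

/-- The standing assumptions of the theorem on `ξ`, `a`, `φ`, `f` and `r`. -/
structure LinearSetting (μ : Measure Ω) (ξ : ℤ → Ω → ℝ) (a : ℤ → ℝ) (φ f : ℝ → ℝ) (r : ℝ) :
    Prop where
  meas : ∀ n, Measurable (ξ n)
  indep : iIndepFun ξ μ
  ident : ∀ n, IdentDistrib (ξ n) (ξ 0) μ μ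
  one_le : 1 ≤ r
  memLp : MemLp (ξ 0) (ENNReal.ofReal (2 * r)) μ
  summable : Summable fun n => |a n|
  classLambda : IsClassLambda φ
  modulus : HasModulus φ f r

namespace LinearSetting

theorem measurable_f (h : LinearSetting μ ξ a φ f r) : Measurable f :=
  (h.modulus.continuous h.classLambda (by linarith [h.one_le])).measurable

theorem measurable_comp_indicator (h : LinearSetting μ ξ a φ f r) (S : Set ℤ) :
    Measurable[idxSigma ξ {j | -j ∉ S}] fun ω => f (linProcess (Sᶜ.indicator a) ξ 0 ω) := by
  refine h.measurable_f.comp (measurable_linProcess fun k hk => ?_)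
  have := Set.mem_of_indicator_ne_zero hk
  simpa using this

variable [IsProbabilityMeasure μ]

theorem memLp_comp (h : LinearSetting μ ξ a φ f r) (n : ℤ) {b : ℤ → ℝ}
    (hb : Summable fun n => |b n|) : MemLp (fun ω => f (linProcess b ξ n ω)) 2 μ := by
  have hr := h.one_le
  refine memLp_comp_of_hasModulus h.classLambda hr h.modulus (measurable_linProcess' h.meas b n) ?_
  exact (eLpNorm_linProcess_le h.meas h.ident hb (by linarith) n).trans_lt
    (ENNReal.mul_lt_top ENNReal.ofReal_lt_top h.memLp.eLpNorm_lt_top)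

theorem memLp_centered (h : LinearSetting μ ξ a φ f r) (n : ℤ) :
    MemLp (funLinProcess μ f a ξ n) 2 μ :=
  (h.memLp_comp n h.summable).sub (memLp_const _)

/-- The effect on `f (Y_0)` of deleting the coefficients with index in `S`. -/
def delta (a : ℤ → ℝ) (ξ : ℤ → Ω → ℝ) (f : ℝ → ℝ) (S : Set ℤ) (ω : Ω) : ℝ :=
  f (linProcess a ξ 0 ω) - f (linProcess (Sᶜ.indicator a) ξ 0 ω)

theorem memLp_delta (h : LinearSetting μ ξ a φ f r) (S : Set ℤ) : MemLp (delta a ξ f S) 2 μ :=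
  (h.memLp_comp 0 h.summable).sub (h.memLp_comp 0 (summable_abs_indicator h.summable _))

theorem martProj_centered (h : LinearSetting μ ξ a φ f r) {S : Set ℤ} {i : ℤ} (hi : -i ∈ S) :
    martProj μ ξ i (funLinProcess μ f a ξ 0) =ᵐ[μ] martProj μ ξ i (delta a ξ f S) := by
  set c := ∫ ω', f (linProcess a ξ 0 ω') ∂μ
  set g : Ω → ℝ := fun ω => f (linProcess (Sᶜ.indicator a) ξ 0 ω) - c with hg
  have hgi : Integrable g μ := ((h.memLp_comp 0 (summable_abs_indicator h.summable Sᶜ)).sub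
    (memLp_const c)).integrable (by norm_num)
  have hsplit : funLinProcess μ f a ξ 0 = delta a ξ f S + g := by
    ext ω
    simp only [funLinProcess, delta, hg, Pi.add_apply]
    ring
  have h0 : martProj μ ξ i g =ᵐ[μ] 0 := by
    refine martProj_eq_zero h.meas h.indep (S := {j | -j ∉ S}) (by simpa using hi) ?_ hgi
    exact (measurable_id.sub_const c).comp (h.measurable_comp_indicator S)
  rw [hsplit]
  filter_upwards [martProj_add (ξ := ξ) (n := i)
    ((h.memLp_delta S).integrable (by norm_num)) hgi, h0] with ω h1 h2
  rw [h1, Pi.add_apply, h2, Pi.zero_apply, add_zero]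

theorem hannanNorm_lt_top (h : LinearSetting μ ξ a φ f r)
    (hsum : Summable (fun n : ℤ => φ |a n|) ∨
      Summable fun n : ℕ => φ (absTail a (n + 1)) / √((n : ℝ) + 1)) :
    hannanNorm μ ξ (funLinProcess μ f a ξ 0) < ∞ := by
  obtain ⟨C, hC0, hC⟩ := exists_eLpNorm_sub_le h.meas h.indep h.ident h.summable h.one_le h.memLp
    h.classLambda h.modulus
  have hC : ∀ S : Set ℤ, eLpNorm (delta a ξ f S) 2 μ ≤
      ENNReal.ofReal (C * φ (∑' k, |S.indicator a k|)) := hC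
  have hφ := h.classLambda
  rcases hsum with hs | hs
  · have hb : ∀ i : ℤ, eLpNorm (martProj μ ξ i (funLinProcess μ f a ξ 0)) 2 μ ≤
        2 * ENNReal.ofReal (C * φ |a (-i)|) := by
      intro i
      have h1 : ∑' k, |({-i} : Set ℤ).indicator a k| = |a (-i)| := by
        rw [tsum_eq_single (-i) fun k hk => by simp [hk]]
        simp
      have h2 := hC {-i}
      rw [h1] at h2
      rw [eLpNorm_congr_ae (h.martProj_centered (S := {-i}) rfl)]
      refine (eLpNorm_sub_le integrable_condExp.aestronglyMeasurable
        integrable_condExp.aestronglyMeasurable (by norm_num)).trans ?_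
      rw [two_mul]
      exact add_le_add ((eLpNorm_condExp_le_eLpNorm _ (by norm_num)).trans h2)
        ((eLpNorm_condExp_le_eLpNorm _ (by norm_num)).trans h2)
    refine (ENNReal.tsum_le_tsum hb).trans_lt ?_
    have h3 : Summable fun i : ℤ => C * φ |a (-i)| :=
      ((Equiv.neg ℤ).summable_iff.2 hs).mul_left C
    rw [ENNReal.tsum_mul_left, ← ENNReal.ofReal_tsum_of_nonneg
      (fun i => mul_nonneg hC0 (hφ.nonneg (abs_nonneg _))) h3]
    finiteness
  · set c : ℤ → ℝ := fun i =>
      (eLpNorm (martProj μ ξ i (funLinProcess μ f a ξ 0)) 2 μ).toReal with hc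
    have hfin : ∀ i, eLpNorm (martProj μ ξ i (funLinProcess μ f a ξ 0)) 2 μ ≠ ∞ := fun i =>
      (memLp_martProj i (h.memLp_centered 0)).eLpNorm_lt_top.ne
    have hanti : Antitone fun n => φ (absTail a n) := fun m n hmn =>
      hφ.monotoneOn (Set.mem_Ici.2 (absTail_nonneg a n)) (Set.mem_Ici.2 (absTail_nonneg a m))
        (absTail_antitone h.summable hmn)
    have hbs := summable_sqrt_two_pow_mul (fun n => hφ.nonneg (absTail_nonneg a n)) hanti hs
    have hsc : Summable c := by
      refine summable_of_dyadic (b := fun j => 2 * C * (√(2 ^ j) * φ (absTail a (2 ^ j))))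
        (fun i => ENNReal.toReal_nonneg) (fun j => ?_) (hbs.mul_left (2 * C)) fun j => ?_
      · have := hφ.nonneg (absTail_nonneg a (2 ^ j))
        positivity
      set S : Set ℤ := {k : ℤ | ((2 ^ j : ℕ) : ℤ) ≤ |k|} with hS
      set s := Finset.Ioo (-2 ^ (j + 1) : ℤ) (2 ^ (j + 1)) \ Finset.Ioo (-2 ^ j : ℤ) (2 ^ j) with hs
      have hcard : (s.card : ℝ) ≤ 4 * 2 ^ j := by
        have h1 : s.card ≤ 4 * 2 ^ j := by
          refine (Finset.card_le_card Finset.sdiff_subset).trans ?_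
          rw [Int.card_Ioo]
          have : (2 : ℤ) ^ (j + 1) = 2 * 2 ^ j := by ring
          have h2 : (2 : ℤ) ^ j = ((2 ^ j : ℕ) : ℤ) := by push_cast; rfl
          rw [this, h2]
          lia
        exact_mod_cast h1
      have hci : ∀ i ∈ s, c i = (eLpNorm (martProj μ ξ i (delta a ξ f S)) 2 μ).toReal := by
        intro i hi
        have hiS : -i ∈ S := by
          simp only [hs, Finset.mem_sdiff, Finset.mem_Ioo, not_and, not_lt] at hi
          simp only [hS, Set.mem_ofPred_eq, abs_neg]
          push_cast
          rcases le_or_gt i (-2 ^ j) with h1 | h1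
          · exact le_trans (by linarith) (neg_le_abs i)
          · exact (hi.2 h1).trans (le_abs_self i)
        rw [hc]
        simp only
        rw [eLpNorm_congr_ae (h.martProj_centered hiS)]
      have hbess := sum_eLpNorm_martProj_sq_le h.meas (h.memLp_delta S) s
      have hsq : ∑ i ∈ s, c i ^ 2 ≤ (C * φ (absTail a (2 ^ j))) ^ 2 := by
        rw [Finset.sum_congr rfl fun i hi => by rw [hci i hi]]
        refine hbess.trans (pow_le_pow_left₀ ENNReal.toReal_nonneg ?_ 2)
        exact ENNReal.toReal_le_of_le_ofReal
          (mul_nonneg hC0 (hφ.nonneg (absTail_nonneg a _))) (hC S)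
      have hCS := sq_sum_le_card_mul_sum_sq (s := s) (f := c)
      refine le_of_sq_le_sq (hCS.trans ?_) (by
        have := hφ.nonneg (absTail_nonneg a (2 ^ j))
        positivity)
      refine (mul_le_mul hcard hsq (Finset.sum_nonneg fun _ _ => sq_nonneg _)
        (by positivity)).trans (le_of_eq ?_)
      rw [mul_pow, mul_pow, mul_pow, mul_pow, Real.sq_sqrt (by positivity)]
      ring
    have h3 : hannanNorm μ ξ (funLinProcess μ f a ξ 0) = ∑' i, ENNReal.ofReal (c i) :=
      tsum_congr fun i => (ENNReal.ofReal_toReal (hfin i)).symm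
    rw [h3, ← ENNReal.ofReal_tsum_of_nonneg (fun i => ENNReal.toReal_nonneg) hsc]
    exact ENNReal.ofReal_lt_top

theorem tendsto_eLpNorm_delta (h : LinearSetting μ ξ a φ f r) :
    Tendsto (fun n : ℕ => 2 * eLpNorm (delta a ξ f {k : ℤ | (n : ℤ) ≤ |k|}) 2 μ) atTop (𝓝 0) := by
  obtain ⟨C, hC0, hC⟩ := exists_eLpNorm_sub_le h.meas h.indep h.ident h.summable h.one_le h.memLp
    h.classLambda h.modulus
  have h1 := ENNReal.tendsto_ofReal ((tendsto_comp_absTail h.classLambda h.summable).const_mul C)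
  rw [mul_zero, ENNReal.ofReal_zero] at h1
  have h2 : Tendsto (fun n : ℕ => eLpNorm (delta a ξ f {k : ℤ | (n : ℤ) ≤ |k|}) 2 μ) atTop (𝓝 0) :=
    tendsto_of_tendsto_of_tendsto_of_le_of_le tendsto_const_nhds h1 (fun _ => zero_le)
      fun n => hC _
  simpa using ENNReal.Tendsto.const_mul h2 (Or.inr ENNReal.ofNat_ne_top)

theorem tendsto_condExp_past (h : LinearSetting μ ξ a φ f r) :
    Tendsto (fun n : ℕ => eLpNorm (μ[funLinProcess μ f a ξ 0 | pastSigma ξ (-n)]) 2 μ)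
      atTop (𝓝 0) := by
  refine tendsto_of_tendsto_of_tendsto_of_le_of_le tendsto_const_nhds h.tendsto_eLpNorm_delta
    (fun _ => zero_le) fun n => ?_
  set S : Set ℤ := {k : ℤ | (n : ℤ) ≤ |k|} with hS
  set d := delta a ξ f S with hd
  set g : Ω → ℝ := fun ω => f (linProcess (Sᶜ.indicator a) ξ 0 ω) with hg
  have hgL : MemLp g 2 μ := h.memLp_comp 0 (summable_abs_indicator h.summable Sᶜ)
  have hgi : Integrable g μ := hgL.integrable (by norm_num)
  have hdL := h.memLp_delta S
  have hdi : Integrable d μ := hdL.integrable (by norm_num)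
  have hF := pastSigma_le h.meas
  have hsplit : funLinProcess μ f a ξ 0 = d + (g - fun _ => (∫ ω, d ω ∂μ) + ∫ ω, g ω ∂μ) := by
    ext ω
    have h1 : ∫ ω, f (linProcess a ξ 0 ω) ∂μ = (∫ ω, d ω ∂μ) + ∫ ω, g ω ∂μ := by
      rw [← integral_add hdi hgi]
      simp [hd, delta, hg]
    simp only [funLinProcess, Pi.add_apply, Pi.sub_apply, h1]
    simp [hd, delta, hg]
  have hdisj : Disjoint {j : ℤ | -j ∉ S} (Set.Iic (-n : ℤ)) := by
    rw [Set.disjoint_left]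
    intro j hj hj'
    have h1 : j ≤ -n := hj'
    simp only [hS, Set.mem_ofPred_eq, abs_neg, not_le] at hj
    have := neg_le_abs j
    lia
  have hgc : μ[g | pastSigma ξ (-n)] =ᵐ[μ] fun _ => ∫ ω, g ω ∂μ :=
    condExp_indep_eq (idxSigma_le h.meas _) (hF _)
      (h.measurable_comp_indicator S).stronglyMeasurable (indep_idxSigma h.meas h.indep hdisj)
  have heq : μ[funLinProcess μ f a ξ 0 | pastSigma ξ (-n)] =ᵐ[μ]
      μ[d | pastSigma ξ (-n)] - fun _ => ∫ ω, d ω ∂μ := by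
    rw [hsplit]
    filter_upwards [condExp_add hdi (hgi.sub (integrable_const _)) (pastSigma ξ (-n)),
      condExp_sub hgi (integrable_const ((∫ ω, d ω ∂μ) + ∫ ω, g ω ∂μ)) (pastSigma ξ (-n)), hgc]
      with ω h1 h2 h3
    rw [h1, Pi.add_apply, h2, Pi.sub_apply, h3, condExp_const (hF _), Pi.sub_apply]
    ring
  rw [eLpNorm_congr_ae heq, two_mul]
  refine (eLpNorm_sub_le integrable_condExp.aestronglyMeasurable aestronglyMeasurable_const
    (by norm_num)).trans (add_le_add (eLpNorm_condExp_le_eLpNorm _ (by norm_num)) ?_)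
  rw [← condExp_bot (μ := μ) d]
  exact eLpNorm_condExp_le_eLpNorm _ (by norm_num)

theorem tendsto_condExp_future (h : LinearSetting μ ξ a φ f r) :
    Tendsto (fun n : ℕ => eLpNorm (μ[funLinProcess μ f a ξ 0 | pastSigma ξ n] -
      funLinProcess μ f a ξ 0) 2 μ) atTop (𝓝 0) := by
  refine tendsto_of_tendsto_of_tendsto_of_le_of_le tendsto_const_nhds h.tendsto_eLpNorm_delta
    (fun _ => zero_le) fun n => ?_
  set S : Set ℤ := {k : ℤ | (n : ℤ) ≤ |k|} with hS
  set d := delta a ξ f S with hd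
  set c := ∫ ω', f (linProcess a ξ 0 ω') ∂μ
  set g : Ω → ℝ := fun ω => f (linProcess (Sᶜ.indicator a) ξ 0 ω) - c with hg
  have hgi : Integrable g μ := ((h.memLp_comp 0 (summable_abs_indicator h.summable Sᶜ)).sub
    (memLp_const c)).integrable (by norm_num)
  have hdL := h.memLp_delta S
  have hdi : Integrable d μ := hdL.integrable (by norm_num)
  have hF := pastSigma_le h.meas
  have hsplit : funLinProcess μ f a ξ 0 = d + g := by
    ext ω
    simp only [funLinProcess, hd, delta, hg, Pi.add_apply]
    ring
  have hsub : {j : ℤ | -j ∉ S} ⊆ Set.Iic (n : ℤ) := by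
    intro j hj
    simp only [hS, Set.mem_ofPred_eq, abs_neg, not_le] at hj
    exact (le_abs_self j).trans hj.le
  have hgm : StronglyMeasurable[pastSigma ξ n] g := by
    refine ((measurable_id.sub_const c).comp
      ((h.measurable_comp_indicator S).mono (idxSigma_mono ξ hsub) le_rfl)).stronglyMeasurable
  have hgc : μ[g | pastSigma ξ n] = g := condExp_of_stronglyMeasurable (hF _) hgm hgi
  have heq : μ[funLinProcess μ f a ξ 0 | pastSigma ξ n] - funLinProcess μ f a ξ 0 =ᵐ[μ]
      μ[d | pastSigma ξ n] - d := by
    rw [hsplit]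
    filter_upwards [condExp_add hdi hgi (pastSigma ξ n)] with ω h1
    rw [Pi.sub_apply, h1, Pi.add_apply, hgc, Pi.add_apply, Pi.sub_apply]
    ring
  rw [eLpNorm_congr_ae heq, two_mul]
  exact (eLpNorm_sub_le integrable_condExp.aestronglyMeasurable hdL.aestronglyMeasurable
    (by norm_num)).trans (add_le_add (eLpNorm_condExp_le_eLpNorm _ (by norm_num)) le_rfl)

end LinearSetting

end Setting

section Transfer

variable {Ω : Type*} {mΩ : MeasurableSpace Ω} {μ : Measure Ω} [IsProbabilityMeasure μ]
  {P : Measure (ℤ → ℝ)} [IsProbabilityMeasure P]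

/-- The conclusion transfers from the canonical space along `ω ↦ (ξ j ω)_j`. -/
theorem HannanConclusion.comp {C : ℝ → ℝ} {ξ : ℤ → Ω → ℝ}
    (hπ : MeasurePreserving (fun ω j => ξ j ω) μ P) {X : ℤ → (ℤ → ℝ) → ℝ}
    (hX : ∀ n, Integrable (X n) P) (h : HannanConclusion C P coord X) :
    HannanConclusion C μ ξ fun n ω => X n fun j => ξ j ω := by
  set π : Ω → ℤ → ℝ := fun ω j => ξ j ω with hπdef
  have hcoord : ∀ j, coord j ∘ π = ξ (j + 0) := fun j => by rw [add_zero]; rfl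
  have hproj : ∀ (n : ℤ) {Z : (ℤ → ℝ) → ℝ}, Integrable Z P →
      martProj μ ξ n (Z ∘ π) =ᵐ[μ] martProj P coord n Z ∘ π := fun n Z hZ => by
    have := martProj_comp hπ measurable_coord hcoord n hZ
    rwa [add_zero] at this
  have hmeas : ∀ (n : ℤ) (Y : (ℤ → ℝ) → ℝ), Measurable (martProj P coord n Y) := fun n Y =>
    ((stronglyMeasurable_martProj P coord n Y).mono (pastSigma_le measurable_coord n)).measurable
  have hsigma : ∀ n, (pastSigma coord n).comap π = pastSigma ξ n := fun n => by
    rw [pastSigma_comap π coord n 0 hcoord, add_zero]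
  have hnorm : hannanNorm μ ξ (X 0 ∘ π) = hannanNorm P coord (X 0) := tsum_congr fun n => by
    rw [eLpNorm_congr_ae (hproj n (hX 0)),
      eLpNorm_comp_measurePreserving (hmeas _ _).aestronglyMeasurable hπ]
  obtain ⟨g, hgm, hg1, hg2, hg3, hg4, hg5⟩ := h.martingale_approx
  have hg0 : shiftProcess g ξ 0 = shiftProcess g coord 0 ∘ π := rfl
  have hgae : AEStronglyMeasurable (shiftProcess g coord 0) P := hg2.aestronglyMeasurable
  refine ⟨hnorm ▸ h.hannan_lt_top, fun p hp hp2 => ?_, g, hgm, ?_, ?_, ?_, ?_, ?_⟩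
  · refine le_trans ?_ ((h.maximal p hp hp2).trans (le_of_eq (by rw [← hnorm]; rfl)))
    refine iSup₂_mono fun t ht => mul_le_mul' le_rfl (ENNReal.rpow_le_rpow ?_ (by positivity))
    exact hπ.measure_preimage_le _
  · rw [← hsigma, hg0]
    exact hg1.comp_measurable (comap_measurable π)
  · exact hg2.comp_measurePreserving hπ
  · refine hg3.congr fun s => ?_
    rw [← eLpNorm_comp_measurePreserving
      (hgae.sub (Finset.aestronglyMeasurable_sum s fun m _ => (hmeas _ _).aestronglyMeasurable)) hπ]
    refine eLpNorm_congr_ae ?_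
    have h1 : ∀ᵐ ω ∂μ, ∀ m, martProj μ ξ 1 (X m ∘ π) ω = martProj P coord 1 (X m) (π ω) :=
      ae_all_iff.2 fun m => hproj 1 (hX m)
    filter_upwards [h1] with ω hω
    simp only [Function.comp_apply, Pi.sub_apply, Finset.sum_apply]
    exact congrArg₂ _ rfl (Finset.sum_congr rfl fun m _ => (hω m).symm)
  · have h1 := condExp_comp_measurePreserving hπ (pastSigma_le measurable_coord 0)
      (hg2.integrable (by norm_num))
    rw [hsigma] at h1
    filter_upwards [h1, hπ.quasiMeasurePreserving.ae hg4] with ω h1 h2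
    rw [hg0, h1]
    exact h2
  · exact hπ.quasiMeasurePreserving.ae hg5

end Transfer

section Canonical

variable {ν : Measure ℝ} [IsProbabilityMeasure ν]

theorem iIndepFun_coord : iIndepFun coord (Measure.infinitePi fun _ : ℤ => ν) :=
  iIndepFun_infinitePi (X := fun _ x => x) fun _ => measurable_id

theorem measurePreserving_coord (j : ℤ) :
    MeasurePreserving (coord j) (Measure.infinitePi fun _ : ℤ => ν) ν :=
  measurePreserving_eval_infinitePi (fun _ : ℤ => ν) j

theorem measurePreserving_shiftSeq (k : ℤ) :
    MeasurePreserving (shiftSeq k) (Measure.infinitePi fun _ : ℤ => ν)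
      (Measure.infinitePi fun _ : ℤ => ν) := by
  refine ⟨measurable_shiftSeq k, ?_⟩
  have h1 : iIndepFun (fun j x => coord (j + k) x) (Measure.infinitePi fun _ : ℤ => ν) :=
    iIndepFun_coord.precomp (add_left_injective k)
  have h2 := h1.map_fun_eq_infinitePi_map fun j => measurable_coord (j + k)
  simp only [(measurePreserving_coord (ν := ν) _).map_eq] at h2
  exact h2

end Canonical

end

theorem mainTheorem8 :
    ∃ C : ℝ → ℝ, (∀ p, 1 ≤ p → p < 2 → 0 < C p) ∧
      ∀ (Ω : Type*) [MeasurableSpace Ω] (μ : Measure Ω) [IsProbabilityMeasure μ]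
        (ξ : ℤ → Ω → ℝ) (a : ℤ → ℝ) (φ f : ℝ → ℝ) (r : ℝ),
        (∀ n, Measurable (ξ n)) →
        iIndepFun ξ μ →
        (∀ n, IdentDistrib (ξ n) (ξ 0) μ μ) →
        1 ≤ r →
        MemLp (ξ 0) (ENNReal.ofReal (2 * r)) μ →
        Summable (fun n => |a n|) →
        IsClassLambda φ →
        (∀ x y, |f x - f y| ≤ φ |x - y| * (1 + |x| ^ r + |y| ^ r)) →
        (Summable (fun n : ℤ => φ |a n|) ∨
          Summable (fun n : ℕ =>
            φ (∑' k : {k : ℤ // (n : ℤ) + 1 ≤ |k|}, |a k|) / √((n : ℝ) + 1))) →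
        (∀ n, ∀ᵐ ω ∂μ, Summable (fun k : ℤ => a k * ξ (n - k) ω)) ∧
        (∀ n, MemLp (fun ω => f (linProcess a ξ n ω)) 2 μ) ∧
        HannanConclusion C μ ξ (funLinProcess μ f a ξ) := by
  refine ⟨maxConst, fun p _ _ => maxConst_pos p, ?_⟩
  intro Ω _ μ _ ξ a φ f r hm hind hid hr hL ha hφ hf hsum
  have hset : LinearSetting μ ξ a φ f r := ⟨hm, hind, hid, hr, hL, ha, hφ, hf⟩
  refine ⟨ae_summable_linear hm hid ha (ENNReal.one_le_ofReal.2 (by linarith)) hL,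
    fun n => hset.memLp_comp n ha, ?_⟩
  have hsum' : Summable (fun n : ℤ => φ |a n|) ∨
      Summable fun n : ℕ => φ (absTail a (n + 1)) / √((n : ℝ) + 1) := by
    refine hsum.imp_right fun h => h.congr fun n => ?_
    have : absTail a (n + 1) = ∑' k : {k : ℤ // (n : ℤ) + 1 ≤ |k|}, |a k| :=
      absTail_eq_tsum_subtype a (n + 1)
    rw [this]
  set ν := μ.map (ξ 0) with hν
  have : IsProbabilityMeasure ν := Measure.isProbabilityMeasure_map (hm 0).aemeasurable
  set P := Measure.infinitePi fun _ : ℤ => ν with hP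
  have hπ : MeasurePreserving (fun ω j => ξ j ω) μ P := by
    refine ⟨measurable_pi_lambda _ hm, ?_⟩
    rw [hind.map_fun_eq_infinitePi_map hm, hP]
    congr 1
    funext j
    exact (hid j).map_eq
  have hcid : ∀ n, IdentDistrib (coord n) (coord 0) P P := fun n =>
    ⟨(measurable_coord n).aemeasurable, (measurable_coord 0).aemeasurable, by
      rw [(measurePreserving_coord n).map_eq, (measurePreserving_coord 0).map_eq]⟩
  have hcL : MemLp (coord 0) (ENNReal.ofReal (2 * r)) P := by
    have h1 : IdentDistrib (ξ 0) (coord 0) μ P := ⟨(hm 0).aemeasurable,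
      (measurable_coord 0).aemeasurable, (measurePreserving_coord (ν := ν) 0).map_eq.symm⟩
    exact h1.memLp_iff.1 hL
  have hcan : LinearSetting P coord a φ f r :=
    ⟨measurable_coord, iIndepFun_coord, hcid, hr, hcL, ha, hφ, hf⟩
  have hZm : Measurable (funLinProcess P f a coord 0) :=
    (hcan.measurable_f.comp (measurable_linProcess' measurable_coord a 0)).sub_const _
  have hmain := hannanConclusion_of_stationary (fun k => measurePreserving_shiftSeq k) hZm
    (hcan.memLp_centered 0) (hcan.hannanNorm_lt_top hsum') hcan.tendsto_condExp_past
    hcan.tendsto_condExp_future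
  have hint : ∀ n : ℤ, Integrable (fun x => funLinProcess P f a coord 0 (shiftSeq n x)) P :=
    fun n => ((hcan.memLp_centered 0).comp_measurePreserving
      (measurePreserving_shiftSeq n)).integrable (by norm_num)
  have hfinal := hmain.comp hπ hint
  have hlin : ∀ (n : ℤ) ω, linProcess a coord 0 (shiftSeq n fun j => ξ j ω) =
      linProcess a ξ n ω := fun n ω => by
    refine tsum_congr fun k => ?_
    simp only [coord, shiftSeq]
    rw [show 0 - k + n = n - k by ring]
  have hX : (fun (n : ℤ) ω => funLinProcess P f a coord 0 (shiftSeq n fun j => ξ j ω)) =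
      funLinProcess μ f a ξ := by
    funext n ω
    simp only [funLinProcess, hlin]
    congr 1
    have hmeasf : Measurable fun x => f (linProcess a coord 0 x) :=
      hcan.measurable_f.comp (measurable_linProcess' measurable_coord a 0)
    have h1 := (measurePreserving_shiftSeq (ν := ν) n).integral_comp_of_aestronglyMeasurable
      hmeasf.aestronglyMeasurable
    have h2 : ∫ ω, f (linProcess a coord 0 (shiftSeq n fun j => ξ j ω)) ∂μ =
        ∫ x, f (linProcess a coord 0 (shiftSeq n x)) ∂P :=
      hπ.integral_comp_of_aestronglyMeasurable
        (hmeasf.comp (measurable_shiftSeq n)).aestronglyMeasurable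
    simp only [hlin] at h2
    rw [h2, ← h1]
  rwa [hX] at hfinal
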